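/- Let $\Lambda$ be a nonempty finite set of sites, $N\ge 1$ the number of colors, and let $c_{x,\alpha}$ and $f_{x,\alpha}$ ($x\in\Lambda$, $1\le\alpha\le N$) be the annihilation operators of itinerant and localized fermions, satisfying the canonical anticommutation relations and acting on their joint Fock space $\mathcal H'(\Lambda)$. Let $G^A$ ($1\le A\le N^2-1$) be Hermitian traceless $N\times N$ matrices with $\mathrm{Tr}(G^AG^B)=\delta_{A,B}$ (generators of $\mathrm{SU}(N)$), and put $s^A_x=\sum_{\alpha,\beta}c^\dagger_{x,\alpha}(G^A)_{\alpha,\beta}c_{x,\beta}$ and $S^A_x=\sum_{\alpha,\beta}f^\dagger_{x,\alpha}(G^A)_{\alpha,\beta}f_{x,\beta}$. Let $\mathsf T=(t_{x,y})_{x,y\in\Lambda}$ be a positive semidefinite Hermitian hopping matrix with $D_0=\dim\ker\mathsf T>0$, let $\mathsf P_0$ be the matrix of the orthogonal projection of $\mathbb C^{\Lambda}$ onto $\ker\mathsf T$, and let $\Lambda_0=\{x\in\Lambda : (\mathsf P_0)_{x,x}\ne 0\}$. Let $J_K<0$ and consider the $\mathrm{SU}(N)$ Kondo lattice Hamiltonian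 $$H=\sum_{\alpha=1}^N\sum_{x,y\in\Lambda}t_{x,y}\,c^\dagger_{x,\alpha}c_{y,\alpha}+J_K\sum_{x\in\Lambda}\sum_{A=1}^{N^2-1}s^A_xS^A_x$$ on the states with exactly one localized fermion at each site, $\sum_\alpha f^\dagger_{x,\alpha}f_{x,\alpha}\Psi=\Psi$ for all $x\in\Lambda$, and total particle number $N_{\mathrm{tot}}=D_0+|\Lambda|$ (that is, with $D_0$ itinerant fermions). A ground state is a nonzero eigenvector of $H$ in this space for the lowest eigenvalue of $H$ there. Let $$C=\frac12\Big(\sum_{\alpha,\beta=1}^N F^{\alpha,\beta}F^{\beta,\alpha}-\frac{\hat N_{\mathrm{tot}}^2}{N}\Big),\qquad F^{\alpha,\beta}=\sum_{x\in\Lambda}\big(c^\dagger_{x,\alpha}c_{x,\beta}+f^\dagger_{x,\alpha}f_{x,\beta}\big),\qquad \hat N_{\mathrm{tot}}=\sum_{\alpha=1}^N F^{\alpha,\alpha},$$ be the total quadratic Casimir operator. Suppose that $\Lambda_0=\Lambda$ and that the matrix $\mathsf P_0$ is irreducible, i.e. $\Lambda$ is not the union of two disjoint nonempty subsets $\Lambda_1,\Lambda_2$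 with $(\mathsf P_0)_{x,y}=0$ for all $x\in\Lambda_1$, $y\in\Lambda_2$. Then the model exhibits $\mathrm{SU}(N)$ ferromagnetism: every ground state $\Psi$ satisfies $$C\,\Psi=\frac{N_{\mathrm{tot}}(N-1)}{2}\Big(\frac{N_{\mathrm{tot}}}{N}+1\Big)\Psi ,$$ and this number is the maximum eigenvalue of $C$ on the space of all states in $\mathcal H'(\Lambda)$ with $N_{\mathrm{tot}}$ fermions in total. -/

import Mathlib

open scoped ComplexOrder

namespace KondoLattice

noncomputable section

/-! ### Fermionic Fock space over a finite set of modes -/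

section Fock

variable {ι : Type*} [Fintype ι] [DecidableEq ι]

/-- The fermionic Fock space of a finite set `ι` of modes: the Hilbert space with orthonormal basis
indexed by the sets of occupied modes (the empty set is the vacuum). -/
abbrev Fock (ι : Type*) [Fintype ι] : Type _ := EuclideanSpace ℂ (Finset ι)

/-- The sign picked up when a fermion in mode `i` is created or removed in the configuration `S`,
for a fixed enumeration of the modes: `-1` to the number of occupied modes preceding `i`. -/
def fermionSign (i : ι) (S : Finset ι) : ℂ :=
  (-1) ^ (S.filter fun j => Fintype.equivFin ι j < Fintype.equivFin ι i).card

/-- The annihilation operator of mode `i`. -/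
def annihilate (i : ι) : Module.End ℂ (Fock ι) where
  toFun Ψ := WithLp.toLp 2 fun S => if i ∈ S then 0 else fermionSign i S * Ψ (insert i S)
  map_add' Ψ Φ := by
    ext S
    by_cases h : i ∈ S <;> simp [h, mul_add]
  map_smul' a Ψ := by
    ext S
    by_cases h : i ∈ S <;> simp [h, mul_left_comm]

/-- The creation operator of mode `i`. -/
def create (i : ι) : Module.End ℂ (Fock ι) where
  toFun Ψ := WithLp.toLp 2 fun S => if i ∈ S then fermionSign i S * Ψ (S.erase i) else 0
  map_add' Ψ Φ := by
    ext S
    by_cases h : i ∈ S <;> simp [h, mul_add]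
  map_smul' a Ψ := by
    ext S
    by_cases h : i ∈ S <;> simp [h, mul_left_comm]

end Fock

/-- The (real) eigenvalues of an operator `A` that have a nonzero eigenvector in the subspace `V`. -/
def eigenvaluesIn {E : Type*} [AddCommGroup E] [Module ℂ E]
    (V : Submodule ℂ E) (A : Module.End ℂ E) : Set ℝ :=
  {e | ∃ Φ ∈ V, Φ ≠ 0 ∧ A Φ = (e : ℂ) • Φ}

/-! ### The operators of the SU(N) Kondo lattice model -/

section Model

variable {Λ : Type*} [Fintype Λ] [DecidableEq Λ] {N : ℕ}

/-- The modes: `Sum.inl (x, α)` is the itinerant and `Sum.inr (x, α)` the localized orbital at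
site `x` with color `α`. -/
abbrev Mode (Λ : Type*) (N : ℕ) : Type _ := (Λ × Fin N) ⊕ (Λ × Fin N)

/-- `c_{x,α}` -/
def c (x : Λ) (α : Fin N) : Module.End ℂ (Fock (Mode Λ N)) := annihilate (Sum.inl (x, α))

/-- `c†_{x,α}` -/
def cDag (x : Λ) (α : Fin N) : Module.End ℂ (Fock (Mode Λ N)) := create (Sum.inl (x, α))

/-- `f_{x,α}` -/
def f (x : Λ) (α : Fin N) : Module.End ℂ (Fock (Mode Λ N)) := annihilate (Sum.inr (x, α))

/-- `f†_{x,α}` -/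
def fDag (x : Λ) (α : Fin N) : Module.End ℂ (Fock (Mode Λ N)) := create (Sum.inr (x, α))

/-- The number of localized fermions at site `x`. -/
def nLoc (x : Λ) : Module.End ℂ (Fock (Mode Λ N)) := ∑ α, fDag x α * f x α

/-- `F_tot^{α,β}`: the color raising and lowering operators for `α ≠ β`, the total number of
fermions of color `α` for `α = β`. -/
def fTot (α β : Fin N) : Module.End ℂ (Fock (Mode Λ N)) :=
  ∑ x : Λ, (cDag x α * c x β + fDag x α * f x β)

/-- The total number of fermions, itinerant and localized. -/
def nTot : Module.End ℂ (Fock (Mode Λ N)) := ∑ α : Fin N, fTot (Λ := Λ) α α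

/-- The total quadratic Casimir operator `C_{tot,2}`. -/
def casimir : Module.End ℂ (Fock (Mode Λ N)) :=
  (1 / 2 : ℂ) •
    ((∑ α : Fin N, ∑ β : Fin N, fTot (Λ := Λ) α β * fTot (Λ := Λ) β α)
      - (1 / (N : ℂ)) • (nTot * nTot))

/-- `G^A`, `A = 1, …, N² - 1`, are generators of SU(N) in the fundamental representation with
normalization `Tr (G^A G^B) = δ_{A,B}`: Hermitian traceless matrices, orthonormal for the trace
form. By dimension they form a basis of the traceless matrices, which yields the structure
constants and the completeness relation. -/
structure IsSUGenerators (G : Fin (N ^ 2 - 1) → Matrix (Fin N) (Fin N) ℂ) : Prop where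
  isHermitian : ∀ A, (G A).IsHermitian
  trace_eq_zero : ∀ A, (G A).trace = 0
  trace_mul : ∀ A B, (G A * G B).trace = if A = B then 1 else 0

/-- The SU(N) spin `s_x` of the itinerant fermions at `x` in the direction of the matrix `g`. -/
def spinItin (g : Matrix (Fin N) (Fin N) ℂ) (x : Λ) : Module.End ℂ (Fock (Mode Λ N)) :=
  ∑ α, ∑ β, g α β • (cDag x α * c x β)

/-- The SU(N) spin `S_x` of the localized fermions at `x` in the direction of the matrix `g`. -/
def spinLoc (g : Matrix (Fin N) (Fin N) ℂ) (x : Λ) : Module.End ℂ (Fock (Mode Λ N)) :=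
  ∑ α, ∑ β, g α β • (fDag x α * f x β)

/-- The Hamiltonian `H_KLM` with hopping matrix `T` and Kondo coupling `J`. -/
def hamiltonian (T : Matrix Λ Λ ℂ) (J : ℝ) (G : Fin (N ^ 2 - 1) → Matrix (Fin N) (Fin N) ℂ) :
    Module.End ℂ (Fock (Mode Λ N)) :=
  (∑ α : Fin N, ∑ x, ∑ y, T x y • (cDag x α * c y α))
    + (J : ℂ) • ∑ x, ∑ A, spinItin (G A) x * spinLoc (G A) x

/-- The subspace `W(Λ)` of states with exactly one localized fermion at each site. -/
def oneLocalized (Λ : Type*) [Fintype Λ] [DecidableEq Λ] (N : ℕ) :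
    Submodule ℂ (Fock (Mode Λ N)) :=
  ⨅ x : Λ, LinearMap.eqLocus (nLoc x) LinearMap.id

/-- The subspace `H'_M(Λ)` of all states with `M` fermions in total. -/
def numberSector (Λ : Type*) [Fintype Λ] [DecidableEq Λ] (N : ℕ) (M : ℕ) :
    Submodule ℂ (Fock (Mode Λ N)) :=
  LinearMap.eqLocus nTot ((M : ℂ) • LinearMap.id)

/-- `Ψ` is a ground state of the Kondo lattice model with `M` fermions in total, of which one is
localized at each site: a nonzero eigenvector for the least energy in that sector. -/
def IsGroundState (T : Matrix Λ Λ ℂ) (J : ℝ) (G : Fin (N ^ 2 - 1) → Matrix (Fin N) (Fin N) ℂ)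
    (M : ℕ) (Ψ : Fock (Mode Λ N)) : Prop :=
  Ψ ∈ oneLocalized Λ N ⊓ numberSector Λ N M ∧ Ψ ≠ 0 ∧
    ∃ e : ℝ, IsLeast (eigenvaluesIn (oneLocalized Λ N ⊓ numberSector Λ N M) (hamiltonian T J G)) e ∧
      hamiltonian T J G Ψ = (e : ℂ) • Ψ

/-- The value `M (N - 1) / 2 * (M / N + 1)` of the Casimir operator on fully polarized states of
`M` fermions. -/
def maxCasimir (N M : ℕ) : ℝ := (M : ℝ) * ((N : ℝ) - 1) / 2 * ((M : ℝ) / (N : ℝ) + 1)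

/-- The model with `M` fermions in total exhibits SU(N) ferromagnetism: the number
`M (N - 1) / 2 * (M / N + 1)` is the maximum eigenvalue of the Casimir operator in `H'_M(Λ)`, and
every ground state is an eigenvector for it. -/
def ExhibitsFerromagnetism (T : Matrix Λ Λ ℂ) (J : ℝ)
    (G : Fin (N ^ 2 - 1) → Matrix (Fin N) (Fin N) ℂ) (M : ℕ) : Prop :=
  IsGreatest (eigenvaluesIn (numberSector Λ N M) casimir) (maxCasimir N M) ∧
    ∀ Ψ : Fock (Mode Λ N), IsGroundState T J G M Ψ →
      casimir Ψ = (maxCasimir N M : ℂ) • Ψ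

/-! ### The zero-energy flat band of the hopping matrix -/

/-- `h₀ = ker T`, as a subspace of the single-particle Hilbert space. -/
def flatBand (T : Matrix Λ Λ ℂ) : Submodule ℂ (EuclideanSpace ℂ Λ) :=
  LinearMap.ker (Matrix.toEuclideanLin T)

/-- `D₀ = dim h₀`. -/
def flatBandDim (T : Matrix Λ Λ ℂ) : ℕ := Module.finrank ℂ (flatBand T)

/-- `P₀`: the matrix of the orthogonal projection onto `h₀`. -/
def flatBandProj (T : Matrix Λ Λ ℂ) : Matrix Λ Λ ℂ :=
  Matrix.of fun x y => (flatBand T).starProjection (EuclideanSpace.single y 1) x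

/-- `Λ₀ = {x | (P₀)_{x,x} ≠ 0}`. -/
def flatBandSites (T : Matrix Λ Λ ℂ) : Set Λ := {x | flatBandProj T x x ≠ 0}

/-- The submatrix `(P_{x,y})_{x,y ∈ s}` is reducible: `s` splits into two disjoint nonempty parts
without matrix elements between them. -/
def IsReducibleOn (P : Matrix Λ Λ ℂ) (s : Set Λ) : Prop :=
  ∃ s₁ s₂ : Set Λ, s₁ ∪ s₂ = s ∧ s₁ ∩ s₂ = ∅ ∧ s₁.Nonempty ∧ s₂.Nonempty ∧
    ∀ x ∈ s₁, ∀ y ∈ s₂, P x y = 0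

end Model

end

end KondoLattice

/-! The argument is frustration-free. With one localized fermion per site, the completeness relation
of the generators turns the exchange term into the constant `polarizedEnergy` minus `J` times a sum
of operators `t† t`, where `t` is the `transfer` operator at a site (`hamiltonian_apply`). As `T ≥
0` and `J < 0`, no energy lies below `polarizedEnergy`, and a fully polarized filling of the flat
band attains it (`exists_polarized_state`). Hence in every ground state the itinerant fermions lie
in the flat band and all transfers vanish (`zero_of_energy_le`).

Vanishing of the transfer at `x` makes the two-particle amplitudes of the itinerant and localized
orbitals at `x` symmetric in color and forbids two itinerant fermions at `x`. Choose a basis `ν z`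
of the flat band dual to sites `e z`. The orbitals `z` together with the localized sites are then
exactly as many as the fermions, and none is doubly occupied, so each is singly occupied. This
allows the symmetry relations to be separated orbital by orbital: `z` and the localized site `x` are
symmetric whenever `ν z x ≠ 0`. Symmetry is transitive across singly occupied orbitals, and a class
that missed some localized site would split the projection matrix, against irreducibility. So all
pairs are symmetric (`IsFlat.symmetricPair`).

Normal ordering shows that the Casimir operator is its claimed maximum minus a quarter of the
squared norms of the antisymmetrized amplitudes, in expectation. This gives both the upper bound and
the eigenvalue on color-symmetric states. -/

namespace KondoLattice

/-! ### Anticommutation relations and adjoints on Fock space -/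

section FockCAR

variable {ι : Type*} [Fintype ι] [DecidableEq ι]

lemma annihilate_apply (i : ι) (Ψ : Fock ι) (S : Finset ι) :
    annihilate i Ψ S = if i ∈ S then 0 else fermionSign i S * Ψ (insert i S) := rfl

lemma create_apply (i : ι) (Ψ : Fock ι) (S : Finset ι) :
    create i Ψ S = if i ∈ S then fermionSign i S * Ψ (S.erase i) else 0 := rfl

lemma fermionSign_insert_self (i : ι) (S : Finset ι) :
    fermionSign i (insert i S) = fermionSign i S := by
  simp [fermionSign, Finset.filter_insert]

lemma fermionSign_erase_self (i : ι) (S : Finset ι) :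
    fermionSign i (S.erase i) = fermionSign i S := by
  simp [fermionSign, Finset.filter_erase]

lemma fermionSign_insert {i j : ι} {S : Finset ι} (h : i ∉ S) :
    fermionSign j (insert i S) =
      (if Fintype.equivFin ι i < Fintype.equivFin ι j then -1 else 1) * fermionSign j S := by
  unfold fermionSign
  rw [Finset.filter_insert]
  split_ifs
  · rw [Finset.card_insert_of_notMem (by simp [h]), pow_succ']
  · simp

lemma fermionSign_mul_self {ι : Type*} [Fintype ι] (i : ι) (S : Finset ι) :
    fermionSign i S * fermionSign i S = 1 := by
  unfold fermionSign
  rw [← pow_add, ← two_mul, pow_mul]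
  simp

lemma star_fermionSign {ι : Type*} [Fintype ι] (i : ι) (S : Finset ι) :
    (starRingEnd ℂ) (fermionSign i S) = fermionSign i S := by
  simp [fermionSign]

/-- Exactly one of the two modes precedes the other, so exactly one of the two orders of filling
picks up an extra sign. All anticommutation relations rest on this. -/
lemma fermionSign_swap {i j : ι} (hij : i ≠ j) {S : Finset ι} (hi : i ∉ S) (hj : j ∉ S) :
    fermionSign i S * fermionSign j (insert i S) =
      -(fermionSign j S * fermionSign i (insert j S)) := by
  rw [fermionSign_insert hi, fermionSign_insert hj]
  have hne : Fintype.equivFin ι i ≠ Fintype.equivFin ι j := by simpa using hij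
  rcases lt_or_gt_of_ne hne with h | h
  · rw [if_pos h, if_neg h.not_gt]; ring
  · rw [if_neg h.not_gt, if_pos h]; ring

lemma annihilate_annihilate (i j : ι) (Ψ : Fock ι) :
    annihilate i (annihilate j Ψ) = -annihilate j (annihilate i Ψ) := by
  ext S
  simp only [annihilate_apply, PiLp.neg_apply]
  by_cases hij : i = j
  · subst hij
    simp
  by_cases hi : i ∈ S
  · simp [hi]
  by_cases hj : j ∈ S
  · simp [hj]
  rw [if_neg hi, if_neg hj, if_neg (by simp [hj, Ne.symm hij]), if_neg (by simp [hi, hij]),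
    Finset.insert_comm j i, ← mul_assoc, ← mul_assoc, fermionSign_swap hij hi hj]
  ring

lemma inner_create_left (i : ι) (Ψ Φ : Fock ι) :
    inner ℂ (create i Ψ) Φ = inner ℂ Ψ (annihilate i Φ) := by
  simp only [PiLp.inner_apply, create_apply, annihilate_apply, RCLike.inner_apply]
  rw [← Finset.sum_filter_add_sum_filter_not Finset.univ (fun S => i ∈ S),
    ← Finset.sum_filter_add_sum_filter_not (s := Finset.univ)
      (f := fun S => (if i ∈ S then 0 else _) * _) (fun S => i ∈ S)]
  rw [add_comm]
  congr 1
  · rw [Finset.sum_eq_zero, Finset.sum_eq_zero]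
    · intro S hS; simp [(Finset.mem_filter.1 hS).2]
    · intro S hS; simp [(Finset.mem_filter.1 hS).2]
  · refine Finset.sum_bij' (fun S _ => S.erase i) (fun S _ => insert i S) ?_ ?_ ?_ ?_ ?_
    · intro S hS; simp
    · intro S hS; simp
    · intro S hS; exact Finset.insert_erase (Finset.mem_filter.1 hS).2
    · intro S hS; exact Finset.erase_insert (Finset.mem_filter.1 hS).2
    · intro S hS
      have h := (Finset.mem_filter.1 hS).2
      simp only [h, if_true, Finset.notMem_erase, if_false, Finset.insert_erase h, map_mul,
        star_fermionSign, fermionSign_erase_self]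
      ring

lemma inner_create_right (i : ι) (Ψ Φ : Fock ι) :
    inner ℂ Ψ (create i Φ) = inner ℂ (annihilate i Ψ) Φ := by
  rw [← inner_conj_symm, inner_create_left, inner_conj_symm]

lemma create_create (i j : ι) (Ψ : Fock ι) :
    create i (create j Ψ) = -create j (create i Ψ) := by
  refine ext_inner_right ℂ fun Φ => ?_
  simp only [inner_neg_left, inner_create_left]
  rw [annihilate_annihilate, inner_neg_right]

lemma annihilate_create (i j : ι) (Ψ : Fock ι) :
    annihilate i (create j Ψ) = (if i = j then Ψ else 0) - create j (annihilate i Ψ) := by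
  by_cases hij : i = j
  · subst hij
    ext S
    simp only [annihilate_apply, create_apply, if_true, PiLp.sub_apply]
    by_cases hi : i ∈ S
    · simp only [hi, if_true, Finset.notMem_erase, if_false, Finset.insert_erase hi,
        fermionSign_erase_self, ← mul_assoc, fermionSign_mul_self]
      ring
    · simp only [hi, if_false, Finset.mem_insert_self, if_true, fermionSign_insert_self,
        Finset.erase_insert hi, ← mul_assoc, fermionSign_mul_self]
      ring
  · rw [if_neg hij]
    ext S
    simp only [annihilate_apply, create_apply, PiLp.sub_apply, PiLp.zero_apply]
    by_cases hi : i ∈ S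
    · simp [hi, hij]
    by_cases hj : j ∈ S
    · obtain ⟨R, hjR, rfl⟩ : ∃ R, j ∉ R ∧ S = insert j R :=
        ⟨S.erase j, by simp, (Finset.insert_erase hj).symm⟩
      have hiR : i ∉ R := fun h => hi (by simp [h])
      have h1 : (insert i (insert j R)).erase j = insert i R := by
        rw [Finset.insert_comm, Finset.erase_insert (by simp [hjR, Ne.symm hij])]
      simp only [hi, if_false, Finset.mem_insert, true_or, or_true, if_true, h1,
        Finset.erase_insert hjR, hiR]
      rw [fermionSign_insert_self, Finset.insert_comm, fermionSign_insert_self]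
      have h2 := fermionSign_swap hij hiR hjR
      have h3 := fermionSign_mul_self j R
      have h4 := fermionSign_mul_self j (insert i R)
      generalize fermionSign i R = p at *
      generalize fermionSign j R = q at *
      generalize fermionSign i (insert j R) = p' at *
      generalize fermionSign j (insert i R) = q' at *
      linear_combination (Ψ (insert i R)) * (q * q' * h2 - p' * q' * h3 - p * q * h4)
    · simp [hi, hj, Ne.symm hij]

end FockCAR

/-- A family of annihilation operators `a` and creation operators `d` on `E` satisfying the
canonical anticommutation relations; `d i` need not be the adjoint of `a i`. -/
structure IsCAR {ι E : Type*} [DecidableEq ι] [AddCommGroup E] [Module ℂ E]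
    (a d : ι → Module.End ℂ E) : Prop where
  aa : ∀ i j v, a i (a j v) = -a j (a i v)
  dd : ∀ i j v, d i (d j v) = -d j (d i v)
  ad : ∀ i j v, a i (d j v) = (if i = j then v else 0) - d j (a i v)

lemma isCAR_fock {ι κ : Type*} [Fintype ι] [DecidableEq ι] [DecidableEq κ] {e : κ → ι}
    (he : Function.Injective e) :
    IsCAR (fun k => annihilate (e k)) (fun k => create (e k)) where
  aa _ _ := annihilate_annihilate _ _
  dd _ _ := create_create _ _
  ad i j v := by simp only [annihilate_create, he.eq_iff]

/-! ### Consequences of the anticommutation relations, without adjoints -/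

section CAR

variable {O K E : Type*} [AddCommGroup E] [Module ℂ E]

lemma eq_zero_of_eq_neg {v : E} (hv : v = -v) : v = 0 := by
  have h2 : (2 : ℂ) • v = 0 := by rw [two_smul]; nth_rw 1 [hv]; exact neg_add_cancel v
  exact (smul_eq_zero.1 h2).resolve_left two_ne_zero

/-- The two-particle amplitudes of `Ψ` on the orbitals `o` and `p` are symmetric in the internal
states. -/
def SymmetricPair (a : O × K → Module.End ℂ E) (Ψ : E) (o p : O) : Prop :=
  ∀ α β, a (o, α) (a (p, β) Ψ) = a (o, β) (a (p, α) Ψ)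

lemma IsCAR.symmetricPair_symm [DecidableEq O] [DecidableEq K] {a d : O × K → Module.End ℂ E}
    (h : IsCAR a d) {Ψ : E} {o p : O} (hop : SymmetricPair a Ψ o p) :
    SymmetricPair a Ψ p o := by
  intro α β
  rw [h.aa, hop, h.aa, neg_neg]

variable [Fintype K]

/-- The number operator of the orbital `o`, summed over the internal states `K`. -/
def occupation (a d : O × K → Module.End ℂ E) (o : O) : Module.End ℂ E :=
  ∑ γ, d (o, γ) * a (o, γ)

lemma occupation_apply (a d : O × K → Module.End ℂ E) (o : O) (v : E) :
    occupation a d o v = ∑ γ, d (o, γ) (a (o, γ) v) := by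
  simp [occupation, LinearMap.sum_apply]

namespace IsCAR

variable [DecidableEq O] [DecidableEq K] {a d : O × K → Module.End ℂ E} (h : IsCAR a d)
include h

lemma occupation_annihilate (o p : O) (α : K) (v : E) :
    occupation a d o (a (p, α) v) =
      a (p, α) (occupation a d o v) - if p = o then a (p, α) v else 0 := by
  simp only [occupation_apply, map_sum, h.ad, Prod.mk.injEq]
  rw [Finset.sum_sub_distrib]
  have h1 : ∑ γ, (if p = o ∧ α = γ then a (o, γ) v else 0) = if p = o then a (p, α) v else 0 := by
    by_cases hp : p = o
    · subst hp; simp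
    · simp [hp]
  rw [h1, sub_sub_cancel_left, ← Finset.sum_neg_distrib]
  refine Finset.sum_congr rfl fun γ _ => ?_
  rw [h.aa, map_neg]

lemma occupation_create (o p : O) (α : K) (v : E) :
    occupation a d o (d (p, α) v) =
      d (p, α) (occupation a d o v) + if p = o then d (p, α) v else 0 := by
  simp only [occupation_apply, map_sum, h.ad, Prod.mk.injEq, map_sub]
  rw [Finset.sum_sub_distrib]
  have h1 : ∑ γ, d (o, γ) (if o = p ∧ γ = α then v else 0) = if p = o then d (p, α) v else 0 := by
    by_cases hp : p = o
    · subst hp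
      rw [Finset.sum_eq_single α] <;> simp +contextual
    · simp [hp, Ne.symm hp]
  rw [h1, add_comm, sub_eq_add_neg, ← Finset.sum_neg_distrib]
  congr 1
  refine Finset.sum_congr rfl fun γ _ => ?_
  rw [h.dd, neg_neg]

lemma occupation_comm (o p : O) (v : E) :
    occupation a d o (occupation a d p v) = occupation a d p (occupation a d o v) := by
  rw [occupation_apply a d p, occupation_apply a d p, map_sum]
  refine Finset.sum_congr rfl fun γ _ => ?_
  rw [h.occupation_create, h.occupation_annihilate]
  split_ifs <;> simp

section Exclusion

variable [Fintype O]

/-- A state of `k` particles without double occupancies that is confined to fewer than `k`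
orbitals vanishes. -/
lemma eq_zero_of_exclusion (k : ℕ) (S : Finset O) (Φ : E)
    (hn : ∑ o, occupation a d o Φ = (k : ℂ) • Φ)
    (hS : ∀ o ∉ S, ∀ γ, a (o, γ) Φ = 0)
    (hex : ∀ o α β, a (o, α) (a (o, β) Φ) = 0) (hk : S.card < k) : Φ = 0 := by
  induction k generalizing S Φ with
  | zero => omega
  | succ k ih =>
    have hz : ∀ o γ, a (o, γ) Φ = 0 := by
      intro o γ
      by_cases ho : o ∈ S
      -- Removing a particle from `o` leaves `k` particles without double occupancies, confined to
      -- the orbitals of `S` other than `o`.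
      · refine ih (S.erase o) _ ?_ ?_ ?_ ?_
        · simp only [h.occupation_annihilate, Finset.sum_sub_distrib, ← map_sum, hn]
          simp only [Finset.sum_ite_eq, Finset.mem_univ, if_true, map_smul]
          push_cast
          rw [add_smul, one_smul, add_sub_cancel_right]
        · intro p hp δ
          by_cases hpo : p = o
          · subst hpo; exact hex _ _ _
          · rw [h.aa, hS p (fun hm => hp (Finset.mem_erase.2 ⟨hpo, hm⟩)), map_zero, neg_zero]
        · intro p α β
          rw [h.aa (p, β), map_neg, h.aa (p, α), hex, map_zero, neg_zero, neg_zero]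
        · have := Finset.card_pos.2 ⟨o, ho⟩
          rw [Finset.card_erase_of_mem ho]; omega
      · exact hS o ho γ
    have h0 : ((k + 1 : ℕ) : ℂ) • Φ = 0 := by
      rw [← hn]
      simp [occupation_apply, hz]
    exact (smul_eq_zero.1 h0).resolve_left (Nat.cast_ne_zero.2 k.succ_ne_zero)

/-- As many particles as orbitals and no double occupancies: every orbital is singly occupied. -/
lemma occupation_eq_self {Ψ : E}
    (hn : ∑ o, occupation a d o Ψ = (Fintype.card O : ℂ) • Ψ)
    (hex : ∀ o α β, a (o, α) (a (o, β) Ψ) = 0) (o : O) : occupation a d o Ψ = Ψ := by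
  have hself : ∀ γ, a (o, γ) (occupation a d o Ψ) = a (o, γ) Ψ := by
    intro γ
    have h1 := h.occupation_annihilate o o γ Ψ
    rw [if_pos rfl] at h1
    rw [← sub_eq_zero, ← h1, occupation_apply]
    simp [hex]
  -- The difference of `Ψ` and its image under the number operator of `o` has no particle on `o`,
  -- yet still as many particles as there are orbitals.
  refine (sub_eq_zero.1 (h.eq_zero_of_exclusion (Fintype.card O) (Finset.univ.erase o) _
    ?_ ?_ ?_ ?_)).symm
  · simp only [map_sub, Finset.sum_sub_distrib, hn]
    rw [Finset.sum_congr rfl fun p _ => h.occupation_comm p o Ψ, ← map_sum, hn, map_smul,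
      smul_sub]
  · intro p hp γ
    have : p = o := by simpa using hp
    subst this
    rw [map_sub, hself, sub_self]
  · intro p α β
    by_cases hp : p = o
    · subst hp
      rw [map_sub, hself, sub_self, map_zero]
    · have h2 : ∀ (γ : K) (v : E), a (p, γ) (occupation a d o v) = occupation a d o (a (p, γ) v) := by
        intro γ v
        rw [h.occupation_annihilate, if_neg hp, sub_zero]
      rw [map_sub, map_sub, h2, h2, hex, map_zero, sub_zero]
  · rw [Finset.card_erase_of_mem (Finset.mem_univ o), Finset.card_univ]
    exact Nat.sub_lt (Fintype.card_pos_iff.2 ⟨o⟩) one_pos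

end Exclusion

/-- Since `p` is singly occupied, its color can serve as an intermediary: the exchange of colors
between `o` and `q` is the product of the exchanges `(o p)`, `(p q)`, `(o p)`, each of which leaves
the three-particle amplitudes unchanged. -/
lemma symmetricPair_trans {Ψ : E}
    (hocc : ∀ o, occupation a d o Ψ = Ψ) {o p q : O}
    (hop : SymmetricPair a Ψ o p) (hpq : SymmetricPair a Ψ p q) : SymmetricPair a Ψ o q := by
  by_cases hpo : o = p
  · exact hpo ▸ hpq
  by_cases hqp : q = p
  · exact hqp ▸ hop
  intro α β
  rw [← sub_eq_zero]
  set Φ := a (o, α) (a (q, β) Ψ) - a (o, β) (a (q, α) Ψ) with hΦ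
  have h1 : occupation a d p Φ = Φ := by
    rw [hΦ, map_sub]
    simp only [h.occupation_annihilate, if_neg hpo, if_neg hqp, sub_zero, hocc]
  have hop' : ∀ γ α β, a (p, γ) (a (o, α) (a (q, β) Ψ)) = a (p, α) (a (o, γ) (a (q, β) Ψ)) := by
    intro γ α β
    rw [h.aa (o, α), map_neg, h.aa (p, γ), neg_neg, h.symmetricPair_symm hop, h.aa (q, β),
      ← map_neg, h.aa (q, β), neg_neg]
  have hpq' : ∀ γ α β, a (p, γ) (a (o, α) (a (q, β) Ψ)) = a (p, β) (a (o, α) (a (q, γ) Ψ)) := by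
    intro γ α β
    rw [h.aa (p, γ), hpq, h.aa (o, α), neg_neg]
  rw [← h1, occupation_apply]
  refine Finset.sum_eq_zero fun γ _ => ?_
  rw [hΦ, map_sub, hop' γ α β, hpq' α γ β, hop' β γ α, sub_self, map_zero]

/-- A linear relation between antisymmetrized amplitudes on distinct orbitals splits. -/
lemma symmetricPair_of_sum {κ : Type*} [Fintype κ] [DecidableEq κ] {Ψ : E}
    (hocc : ∀ o, occupation a d o Ψ = Ψ) {e : κ → O} (he : Function.Injective e) {o : O}
    (ho : ∀ z, o ≠ e z) (ν : κ → ℂ)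
    (hsum : ∀ α β, ∑ z, ν z • (a (e z, α) (a (o, β) Ψ) - a (e z, β) (a (o, α) Ψ)) = 0)
    {z : κ} (hz : ν z ≠ 0) : SymmetricPair a Ψ (e z) o := by
  intro α β
  -- The number operator of `e z` kills the term of `z`, which has lost its particle there, and
  -- fixes the others. Subtracting isolates that term.
  have h1 := congrArg (occupation a d (e z)) (hsum α β)
  simp only [map_sum, map_smul, map_sub, map_zero, h.occupation_annihilate, he.eq_iff, if_neg (ho z),
    sub_zero, hocc] at h1
  have h2 := hsum α β
  rw [← Finset.add_sum_erase _ _ (Finset.mem_univ z)] at h1 h2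
  rw [Finset.sum_congr rfl fun w hw => by
    rw [if_neg (Finset.ne_of_mem_erase hw), if_neg (Finset.ne_of_mem_erase hw), sub_zero,
      sub_zero]] at h1
  simp only [if_true, sub_self, smul_zero, zero_add] at h1
  rw [h1, add_zero] at h2
  exact sub_eq_zero.1 ((smul_eq_zero.1 h2).resolve_left hz)

/-- Local consequences of the absence of exchange energy between an itinerant orbital `o` and a
singly occupied localized orbital `p`. -/
lemma symmetricPair_of_exchange {Ψ : E} {o p : O}
    (hff : ∀ α β, a (p, α) (a (p, β) Ψ) = 0)
    (hA : ∑ β, d (p, β) (a (o, β) Ψ) = 0) : SymmetricPair a Ψ p o := by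
  intro γ α
  -- No two particles can be removed from `p` in `Ψ`, so only the two contractions with `d (p, β)`
  -- survive.
  have h1 := congrArg (fun v => a (p, γ) (a (p, α) v)) hA
  have h2 : ∀ β, a (p, γ) (a (p, α) (d (p, β) (a (o, β) Ψ))) =
      (if α = β then a (p, γ) (a (o, β) Ψ) else 0) -
        (if γ = β then a (p, α) (a (o, β) Ψ) else 0) := by
    intro β
    rw [h.ad, map_sub, h.ad, h.aa (p, α) (o, β), map_neg, h.aa (p, γ) (o, β), hff]
    simp only [Prod.mk.injEq, true_and, map_zero, neg_zero, sub_zero, apply_ite (a (p, γ))]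
  simp only [map_sum, map_zero, h2, Finset.sum_sub_distrib, Finset.sum_ite_eq, Finset.mem_univ,
    if_true] at h1
  exact sub_eq_zero.1 h1

/-- With one more particle removed from `p`, the amplitude is antisymmetric in the two colors on `o`
and symmetric under exchange of the color on `p` with one on `o`. Alternating these transpositions
three times gives the amplitude equal to its negative. -/
lemma exclusion_of_exchange {Ψ : E} {o p : O} (hop : o ≠ p) (hocc : occupation a d p Ψ = Ψ)
    (hsym : SymmetricPair a Ψ p o) (δ α : K) : a (o, δ) (a (o, α) Ψ) = 0 := by
  have h1 : occupation a d p (a (o, δ) (a (o, α) Ψ)) = a (o, δ) (a (o, α) Ψ) := by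
    simp only [h.occupation_annihilate, if_neg hop, sub_zero, hocc]
  have hanti : ∀ γ δ α, a (p, γ) (a (o, δ) (a (o, α) Ψ)) =
      -a (p, γ) (a (o, α) (a (o, δ) Ψ)) := by
    intro γ δ α
    rw [h.aa (o, δ), map_neg]
  have hswap : ∀ γ δ α, a (p, γ) (a (o, δ) (a (o, α) Ψ)) = a (p, α) (a (o, δ) (a (o, γ) Ψ)) := by
    intro γ δ α
    rw [h.aa (p, γ), hsym, h.aa (o, δ), neg_neg]
  rw [← h1, occupation_apply]
  refine Finset.sum_eq_zero fun γ _ => ?_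
  have h2 : a (p, γ) (a (o, δ) (a (o, α) Ψ)) = -a (p, γ) (a (o, δ) (a (o, α) Ψ)) := by
    conv_lhs => rw [hanti, hswap, hanti, hswap, hanti, hswap, neg_neg]
  rw [eq_zero_of_eq_neg h2, map_zero]

end IsCAR
end CAR

/-! ### Polarized states, quadratic Casimir operator and completeness relation -/

section Casimir

variable {O K E : Type*} [AddCommGroup E] [Module ℂ E] [DecidableEq O] [DecidableEq K]

/-- A nonzero state in which every orbital is filled with color `k` and no other color is present;
additional operators `b` that anticommute with the creation operators still annihilate it. -/
lemma IsCAR.exists_polarized [Fintype O] {a d : O × K → Module.End ℂ E} (h : IsCAR a d)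
    {ι : Type*} (b : ι → Module.End ℂ E) (hb : ∀ i j v, b i (d j v) = -d j (b i v))
    {vac : E} (hvac : vac ≠ 0) (ha0 : ∀ i, a i vac = 0) (hb0 : ∀ i, b i vac = 0) (k : K) :
    ∃ Φ : E, Φ ≠ 0 ∧ (∀ o β, β ≠ k → a (o, β) Φ = 0) ∧ (∀ o, d (o, k) Φ = 0) ∧
      ∀ i, b i Φ = 0 := by
  -- The induction also records that orbitals outside `S` are empty, which makes the next creation
  -- nonzero.
  have key : ∀ S : Finset O, ∃ Φ : E, Φ ≠ 0 ∧ (∀ o β, β ≠ k → a (o, β) Φ = 0) ∧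
      (∀ o ∈ S, d (o, k) Φ = 0) ∧ (∀ o ∉ S, a (o, k) Φ = 0) ∧ ∀ i, b i Φ = 0 := by
    intro S
    induction S using Finset.induction_on with
    | empty => exact ⟨vac, hvac, fun _ _ _ => ha0 _, by simp, fun _ _ => ha0 _, hb0⟩
    | insert o S ho ih =>
      obtain ⟨Φ, h0, h1, h2, h3, h4⟩ := ih
      refine ⟨d (o, k) Φ, fun hz => h0 ?_, ?_, ?_, ?_, ?_⟩
      · have := h.ad (o, k) (o, k) Φ
        rw [hz, map_zero, h3 o ho, map_zero, if_pos rfl, sub_zero] at this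
        exact this.symm
      · intro p β hβ
        rw [h.ad, h1 p β hβ, map_zero, if_neg (by simp [hβ]), sub_zero]
      · intro p hp
        by_cases hpo : p = o
        · subst hpo
          exact eq_zero_of_eq_neg (h.dd _ _ _)
        · rw [h.dd, h2 p (Finset.mem_of_mem_insert_of_ne hp hpo), map_zero, neg_zero]
      · intro p hp
        rw [Finset.mem_insert, not_or] at hp
        rw [h.ad, h3 p hp.2, map_zero, if_neg (by simp [hp.1]), sub_zero]
      · intro i
        rw [hb, h4, map_zero, neg_zero]
  obtain ⟨Φ, h0, h1, h2, -, h4⟩ := key Finset.univ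
  exact ⟨Φ, h0, h1, fun o => h2 o (Finset.mem_univ o), h4⟩

lemma IsCAR.occupation_of_polarized [Fintype K] {a d : O × K → Module.End ℂ E} (h : IsCAR a d)
    {Φ : E} {k : K} {o : O} (ha : ∀ β, β ≠ k → a (o, β) Φ = 0) (hd : d (o, k) Φ = 0) :
    occupation a d o Φ = Φ := by
  rw [occupation_apply, Finset.sum_eq_single k]
  · have := h.ad (o, k) (o, k) Φ
    rw [hd, map_zero, if_pos rfl] at this
    exact (sub_eq_zero.1 this.symm).symm
  · intro β _ hβ
    rw [ha β hβ, map_zero]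
  · simp

variable [Fintype O] [Fintype K]

/-- The transition operator `∑ₒ d (o, α) a (o, β)` between internal states. -/
def colorOp (a d : O × K → Module.End ℂ E) (α β : K) : Module.End ℂ E :=
  ∑ o, d (o, α) * a (o, β)

/-- The color sum and the squared particle number are both normal ordered. Their quartic terms
differ only by exchanging the two annihilated colors. -/
lemma IsCAR.sum_colorOp_mul {a d : O × K → Module.End ℂ E} (h : IsCAR a d) {M : ℂ} {Ψ : E}
    (hn : ∑ α, colorOp a d α α Ψ = M • Ψ) :
    ∑ α, ∑ β, colorOp a d α β (colorOp a d β α Ψ) =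
      (M * M - M + Fintype.card K * M) • Ψ +
      ∑ α, ∑ β, ∑ o, ∑ p, d (o, α) (d (p, β)
        (a (o, α) (a (p, β) Ψ) - a (o, β) (a (p, α) Ψ))) := by
  have happ : ∀ α β v, colorOp a d α β v = ∑ o, d (o, α) (a (o, β) v) := by
    intro α β v; simp [colorOp, LinearMap.sum_apply]
  have h1 : ∑ α, ∑ β, colorOp a d α β (colorOp a d β α Ψ) =
      (Fintype.card K * M) • Ψ -
        ∑ α, ∑ β, ∑ o, ∑ p, d (o, α) (d (p, β) (a (o, β) (a (p, α) Ψ))) := by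
    have : ∀ α β, colorOp a d α β (colorOp a d β α Ψ) = colorOp a d α α Ψ -
        ∑ o, ∑ p, d (o, α) (d (p, β) (a (o, β) (a (p, α) Ψ))) := by
      intro α β
      simp only [happ, map_sum, h.ad, Prod.mk.injEq, and_true, map_sub, Finset.sum_sub_distrib,
        Finset.sum_ite_eq, Finset.mem_univ, if_true]
    simp only [this, Finset.sum_sub_distrib, Finset.sum_const, Finset.card_univ]
    rw [← Finset.smul_sum, hn, mul_smul, Nat.cast_smul_eq_nsmul]
  have h2 : (M * M) • Ψ = M • Ψ -
      ∑ α, ∑ β, ∑ o, ∑ p, d (o, α) (d (p, β) (a (o, α) (a (p, β) Ψ))) := by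
    rw [mul_smul, ← hn, Finset.smul_sum]
    have : ∀ α, M • colorOp a d α α Ψ = colorOp a d α α Ψ -
        ∑ β, ∑ o, ∑ p, d (o, α) (d (p, β) (a (o, α) (a (p, β) Ψ))) := by
      intro α
      rw [← map_smul, ← hn, map_sum]
      have : ∀ β, colorOp a d α α (colorOp a d β β Ψ) =
          (if α = β then colorOp a d α α Ψ else 0) -
            ∑ o, ∑ p, d (o, α) (d (p, β) (a (o, α) (a (p, β) Ψ))) := by
        intro β
        by_cases hαβ : α = β
        · subst hαβ
          simp only [happ, map_sum, h.ad, Prod.mk.injEq, and_true, map_sub,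
            Finset.sum_sub_distrib, Finset.sum_ite_eq,
            Finset.mem_univ, if_true]
        · simp only [happ, map_sum, h.ad, Prod.mk.injEq, hαβ, and_false, if_false, map_sub,
            Finset.sum_sub_distrib, map_zero, Finset.sum_const_zero]
      simp only [this, Finset.sum_sub_distrib, Finset.sum_ite_eq, Finset.mem_univ, if_true]
    simp only [this, Finset.sum_sub_distrib]
  simp only [map_sub, Finset.sum_sub_distrib]
  rw [h1, add_smul, sub_smul, h2]
  abel

end Casimir

/-- The `N² - 1` generators and the identity are `N²` trace-orthogonal matrices. Orthogonality reads
`V * U = 1` for square matrices, and completeness is `U * V = 1`. The index `none` stands for the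
identity, whose squared norm `N` accounts for the factor `1 / N`. -/
lemma IsSUGenerators.sum_mul {N : ℕ} (hN : 1 ≤ N)
    {G : Fin (N ^ 2 - 1) → Matrix (Fin N) (Fin N) ℂ} (hG : IsSUGenerators G)
    (α β γ δ : Fin N) :
    ∑ A, G A α β * G A γ δ = (if α = δ ∧ β = γ then 1 else 0) -
      (1 / (N : ℂ)) * (if α = β ∧ γ = δ then 1 else 0) := by
  have hN0 : (N : ℂ) ≠ 0 := Nat.cast_ne_zero.2 (by omega)
  let U : Matrix (Fin N × Fin N) (Option (Fin (N ^ 2 - 1))) ℂ :=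
    Matrix.of fun p A => A.elim (if p.1 = p.2 then 1 else 0) fun A => G A p.1 p.2
  let V : Matrix (Option (Fin (N ^ 2 - 1))) (Fin N × Fin N) ℂ :=
    Matrix.of fun A p => A.elim (if p.1 = p.2 then 1 / (N : ℂ) else 0) fun A => G A p.2 p.1
  have htr : ∀ A B : Matrix (Fin N) (Fin N) ℂ,
      ∑ p : Fin N × Fin N, A p.2 p.1 * B p.1 p.2 = (A * B).trace := by
    intro A B
    rw [Fintype.sum_prod_type_right]
    simp [Matrix.trace, Matrix.mul_apply]
  have hVU : V * U = 1 := by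
    ext A B
    rw [Matrix.mul_apply]
    rcases A with _ | A <;> rcases B with _ | B
    · simp only [V, U, Matrix.of_apply, Option.elim, Fintype.sum_prod_type]
      simp [hN0]
    · have := hG.trace_eq_zero B
      simp only [V, U, Matrix.of_apply, Option.elim, Fintype.sum_prod_type]
      simp only [Matrix.trace, Matrix.diag_apply] at this
      simp [← Finset.mul_sum, this]
    · have := hG.trace_eq_zero A
      simp only [V, U, Matrix.of_apply, Option.elim, Fintype.sum_prod_type]
      simp only [Matrix.trace, Matrix.diag_apply] at this
      simp [this]
    · simp only [V, U, Matrix.of_apply, Option.elim]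
      rw [htr, hG.trace_mul, Matrix.one_apply]
      simp
  have hcard : Fintype.card (Fin N × Fin N) = Fintype.card (Option (Fin (N ^ 2 - 1))) := by
    simp only [Fintype.card_prod, Fintype.card_fin, Fintype.card_option]
    have : 1 ≤ N ^ 2 := Nat.one_le_pow _ _ hN
    rw [Nat.sub_add_cancel this, sq]
  have hUV : U * V = 1 := (Matrix.mul_eq_one_comm_of_card_eq _ _ _ hcard).2 hVU
  have := congrFun (congrFun hUV (α, β)) (δ, γ)
  rw [Matrix.mul_apply, Fintype.sum_option] at this
  simp only [V, U, Matrix.of_apply, Option.elim, Matrix.one_apply, Prod.mk.injEq] at this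
  rw [← this]
  by_cases h1 : α = β <;> by_cases h2 : γ = δ <;> simp [h1, h2, eq_comm]

/-! ### Dual sites and reducibility of the flat band -/

section FlatBand

universe u

variable {Λ : Type u} [Fintype Λ] [DecidableEq Λ]

lemma mem_flatBand {T : Matrix Λ Λ ℂ} {v : EuclideanSpace ℂ Λ} :
    v ∈ flatBand T ↔ T.mulVec v.ofLp = 0 := by
  rw [flatBand, LinearMap.mem_ker, Matrix.toLpLin_apply]
  simp

/-- A basis of the flat band that is dual to the evaluations at suitable sites `e z`. -/
lemma exists_dual_sites (T : Matrix Λ Λ ℂ) :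
    ∃ (κ : Type u) (_ : Fintype κ) (_ : DecidableEq κ) (e : κ → Λ) (ν : κ → Λ → ℂ),
      Fintype.card κ = flatBandDim T ∧
      (∀ z w, ν z (e w) = if z = w then 1 else 0) ∧ (∀ z, T.mulVec (ν z) = 0) ∧
      ∀ v : Λ → ℂ, T.mulVec v = 0 → ∀ x, v x = ∑ z, ν z x * v (e z) := by
  classical
  let ev : Λ → Module.Dual ℂ (flatBand T) := fun x =>
    { toFun := fun v => (v : EuclideanSpace ℂ Λ) x
      map_add' := by intros; rfl
      map_smul' := by intros; rfl }
  -- A maximal independent set of site evaluations spans all of them, so its sites already determine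
  -- a vector of the flat band.
  obtain ⟨κ, e, he, hspan, hli⟩ := exists_linearIndependent' ℂ ev
  have : Finite κ := Finite.of_injective e he
  let _ : Fintype κ := Fintype.ofFinite κ
  have hzero : ∀ v : flatBand T, (∀ z, ev (e z) v = 0) → v = 0 := by
    intro v hv
    have hle : Submodule.span ℂ (Set.range ev) ≤ LinearMap.ker (Module.Dual.eval ℂ _ v) := by
      rw [← hspan, Submodule.span_le]
      rintro _ ⟨z, rfl⟩
      exact hv z
    ext x
    exact hle (Submodule.subset_span ⟨x, rfl⟩)
  let R : flatBand T →ₗ[ℂ] (κ → ℂ) := LinearMap.pi fun z => ev (e z)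
  have hR : Function.Injective R := by
    rw [← LinearMap.ker_eq_bot, LinearMap.ker_eq_bot']
    intro v hv
    exact hzero v fun z => congrFun hv z
  have hcard : Fintype.card κ = flatBandDim T := by
    refine le_antisymm ?_ ?_
    · have := hli.fintype_card_le_finrank
      rwa [Subspace.dual_finrank_eq] at this
    · have := LinearMap.finrank_le_finrank_of_injective hR
      rwa [Module.finrank_fintype_fun_eq_card] at this
  let L := LinearEquiv.ofInjectiveOfFinrankEq R hR
    (by rw [Module.finrank_fintype_fun_eq_card, hcard]; rfl)
  have hL : ∀ v z, L v z = (v : EuclideanSpace ℂ Λ) (e z) := fun v z => rfl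
  have hdual : ∀ z w, (L.symm (Pi.single z 1) : EuclideanSpace ℂ Λ) (e w) =
      if z = w then 1 else 0 := by
    intro z w
    rw [← hL, LinearEquiv.apply_symm_apply, Pi.single_apply]
    simp [eq_comm]
  refine ⟨κ, inferInstance, inferInstance, e, fun z x =>
    (L.symm (Pi.single z 1) : EuclideanSpace ℂ Λ) x, hcard, ?_, ?_, ?_⟩
  · exact hdual
  · intro z
    exact mem_flatBand.1 (L.symm (Pi.single z 1)).2
  · intro v hv x
    let v' : flatBand T := ⟨WithLp.toLp 2 v, mem_flatBand.2 hv⟩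
    have h1 : v' = ∑ z, v (e z) • L.symm (Pi.single z 1) := by
      apply L.injective
      ext w
      simp [hL, v', hdual]
    have h2 := congrArg (fun w : flatBand T => (w : EuclideanSpace ℂ Λ) x) h1
    simp only [Submodule.coe_sum, Submodule.coe_smul, WithLp.ofLp_sum, Finset.sum_apply,
      smul_eq_mul, v', WithLp.ofLp_smul, Pi.smul_apply] at h2
    rw [h2]
    exact Finset.sum_congr rfl fun z _ => mul_comm _ _

/-- If the supports of the basis vectors `ν z` respect a set of sites, then so does the projection
onto the flat band. -/
lemma flatBandProj_eq_zero {κ : Type*} [Fintype κ] {T : Matrix Λ Λ ℂ} {e : κ → Λ} {ν : κ → Λ → ℂ}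
    (hν : ∀ z, T.mulVec (ν z) = 0)
    (hexp : ∀ v : Λ → ℂ, T.mulVec v = 0 → ∀ x, v x = ∑ z, ν z x * v (e z))
    (s : Set Λ) (t : Set κ) (hst : ∀ z x, ν z x ≠ 0 → (z ∈ t ↔ x ∈ s))
    {x y : Λ} (hx : x ∉ s) (hy : y ∈ s) : flatBandProj T x y = 0 := by
  classical
  set p : EuclideanSpace ℂ Λ := (flatBand T).starProjection (EuclideanSpace.single y 1) with hp
  have hpm : T.mulVec p.ofLp = 0 := mem_flatBand.1 (Submodule.starProjection_apply_mem _ _)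
  -- The part of column `y` outside `s` stays in the flat band, because each `ν z` lives on one side
  -- of `s`. Hence `⟨w, w⟩ = ⟨w, p⟩ = ⟨w, δ_y⟩ = 0`, as `w` vanishes at `y`.
  let w : EuclideanSpace ℂ Λ := WithLp.toLp 2 fun x => if x ∈ s then 0 else p x
  have hw : w ∈ flatBand T := by
    have h1 : w = ∑ z, (if z ∈ t then 0 else p (e z)) • WithLp.toLp 2 (ν z) := by
      ext x
      simp only [w, WithLp.ofLp_sum, Finset.sum_apply, WithLp.ofLp_smul, Pi.smul_apply, smul_eq_mul]
      split_ifs with hxs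
      · refine (Finset.sum_eq_zero fun z _ => ?_).symm
        by_cases hz : ν z x = 0
        · rw [hz, mul_zero]
        · rw [if_pos ((hst z x hz).2 hxs), zero_mul]
      · rw [hexp p.ofLp hpm x]
        refine Finset.sum_congr rfl fun z _ => ?_
        by_cases hz : ν z x = 0
        · rw [hz, mul_zero, zero_mul]
        · rw [if_neg fun h => hxs ((hst z x hz).1 h), mul_comm]
    rw [h1]
    exact Submodule.sum_mem _ fun z _ => Submodule.smul_mem _ _ (mem_flatBand.2 (hν z))
  have h2 : inner ℂ w w = (0 : ℂ) := by
    have h3 : inner ℂ w w = (inner ℂ w p : ℂ) := by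
      simp only [PiLp.inner_apply, w]
      refine Finset.sum_congr rfl fun x _ => ?_
      split_ifs <;> simp
    rw [h3, hp, ← Submodule.inner_starProjection_left_eq_right,
      Submodule.starProjection_eq_self_iff.2 hw]
    simp [w, EuclideanSpace.inner_single_right, hy]
  have h4 := congrArg (fun v : EuclideanSpace ℂ Λ => v x) (inner_self_eq_zero.1 h2)
  simpa [w, hx, hp, flatBandProj] using h4

end FlatBand

/-! ### The exchange interaction -/

section Exchange

variable {O K E : Type*} [AddCommGroup E] [Module ℂ E] [Fintype K]

/-- The spin of the orbital `o` in the direction of the matrix `g`. -/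
def spin (a d : O × K → Module.End ℂ E) (g : Matrix K K ℂ) (o : O) : Module.End ℂ E :=
  ∑ α, ∑ β, g α β • (d (o, α) * a (o, β))

lemma spin_apply (a d : O × K → Module.End ℂ E) (g : Matrix K K ℂ) (o : O) (v : E) :
    spin a d g o v = ∑ α, ∑ β, g α β • d (o, α) (a (o, β) v) := by
  simp [spin, LinearMap.sum_apply]

/-- The spin exchange with a singly occupied orbital `p`, from the completeness relation. -/
lemma IsCAR.sum_spin_mul_spin [DecidableEq O] [DecidableEq K]
    {a d : O × K → Module.End ℂ E} (h : IsCAR a d) {I : Type*} [Fintype I] {G : I → Matrix K K ℂ} {r : ℂ}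
    (hG : ∀ α β γ δ, ∑ A, G A α β * G A γ δ =
      (if α = δ ∧ β = γ then 1 else 0) - r * (if α = β ∧ γ = δ then 1 else 0))
    {o p : O} (hop : o ≠ p) {Ψ : E} (hocc : occupation a d p Ψ = Ψ) :
    ∑ A, spin a d (G A) o (spin a d (G A) p Ψ) =
      (1 - r) • occupation a d o Ψ -
        ∑ α, d (o, α) (a (p, α) (∑ β, d (p, β) (a (o, β) Ψ))) := by
  have h1 : ∑ A, spin a d (G A) o (spin a d (G A) p Ψ) =
      ∑ α, ∑ β, ∑ γ, ∑ δ, (∑ A, G A α β * G A γ δ) •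
        d (o, α) (a (o, β) (d (p, γ) (a (p, δ) Ψ))) := by
    have : ∀ A, spin a d (G A) o (spin a d (G A) p Ψ) = ∑ α, ∑ β, ∑ γ, ∑ δ,
        (G A α β * G A γ δ) • d (o, α) (a (o, β) (d (p, γ) (a (p, δ) Ψ))) := by
      intro A
      rw [spin_apply]
      refine Finset.sum_congr rfl fun α _ => Finset.sum_congr rfl fun β _ => ?_
      rw [spin_apply]
      simp only [map_sum, map_smul, Finset.smul_sum, smul_smul]
    simp only [this, Finset.sum_smul]
    rw [Finset.sum_comm]
    refine Finset.sum_congr rfl fun α _ => ?_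
    rw [Finset.sum_comm]
    refine Finset.sum_congr rfl fun β _ => ?_
    rw [Finset.sum_comm]
    refine Finset.sum_congr rfl fun γ _ => ?_
    rw [Finset.sum_comm]
  have h2 : ∀ (α β γ δ : K) (v : E), ((if α = δ ∧ β = γ then (1 : ℂ) else 0) -
      r * (if α = β ∧ γ = δ then 1 else 0)) • v =
      (if δ = α then if γ = β then v else 0 else 0) -
        if α = β then if γ = δ then r • v else 0 else 0 := by
    intro α β γ δ v
    by_cases e1 : α = δ <;> by_cases e2 : β = γ <;> by_cases e3 : α = β <;>
      by_cases e4 : γ = δ <;> simp [e1, e2, e3, e4, eq_comm, sub_smul] <;> simp_all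
  have h3 : ∑ α, ∑ β, d (o, α) (a (o, β) (d (p, β) (a (p, α) Ψ))) =
      occupation a d o Ψ - ∑ α, d (o, α) (a (p, α) (∑ β, d (p, β) (a (o, β) Ψ))) := by
    rw [occupation_apply, ← Finset.sum_sub_distrib]
    refine Finset.sum_congr rfl fun α _ => ?_
    have : ∀ β, d (o, α) (a (o, β) (d (p, β) (a (p, α) Ψ))) =
        (if α = β then d (o, α) (a (o, α) Ψ) else 0) -
          d (o, α) (a (p, α) (d (p, β) (a (o, β) Ψ))) := by
      intro β
      have e1 := h.ad (p, α) (p, β) Ψ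
      have e2 : d (p, β) (a (p, α) Ψ) = (if α = β then Ψ else 0) - a (p, α) (d (p, β) Ψ) := by
        rw [e1]; simp
      have e3 : a (o, β) (d (p, β) Ψ) = -d (p, β) (a (o, β) Ψ) := by
        rw [h.ad, if_neg (by simp [hop]), zero_sub]
      rw [e2, map_sub, h.aa (o, β), e3]
      by_cases hαβ : α = β
      · subst hαβ; simp
      · simp [hαβ]
    simp only [this, Finset.sum_sub_distrib, Finset.sum_ite_eq, Finset.mem_univ, if_true, map_sum]
  have h4 : ∑ α, ∑ γ, r • d (o, α) (a (o, α) (d (p, γ) (a (p, γ) Ψ))) =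
      r • occupation a d o Ψ := by
    conv_rhs => rw [← hocc]
    simp only [occupation_apply, map_sum, Finset.smul_sum]
    exact Finset.sum_comm
  rw [h1]
  simp only [hG, h2, Finset.sum_sub_distrib, Finset.sum_ite_irrel, Finset.sum_const_zero,
    Finset.sum_ite_eq, Finset.sum_ite_eq', Finset.mem_univ, if_true]
  rw [h3, h4, sub_smul, one_smul]
  abel

end Exchange

/-! ### Energy and Casimir bounds for the model -/

section Sites

variable {Λ : Type*} [Fintype Λ] [DecidableEq Λ] {N : ℕ}

/-- The annihilation operators, indexed by orbital (`inl x` itinerant, `inr x` localized) and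
color. -/
noncomputable def siteAnn (k : (Λ ⊕ Λ) × Fin N) : Module.End ℂ (Fock (Mode Λ N)) :=
  annihilate (Equiv.sumProdDistrib Λ Λ (Fin N) k)

/-- The creation operators, indexed by orbital and color. -/
noncomputable def siteCre (k : (Λ ⊕ Λ) × Fin N) : Module.End ℂ (Fock (Mode Λ N)) :=
  create (Equiv.sumProdDistrib Λ Λ (Fin N) k)

lemma isCAR_site : IsCAR (siteAnn (Λ := Λ) (N := N)) siteCre :=
  isCAR_fock (Equiv.sumProdDistrib Λ Λ (Fin N)).injective

lemma inner_siteCre (k : (Λ ⊕ Λ) × Fin N) (Ψ Φ : Fock (Mode Λ N)) :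
    inner ℂ Ψ (siteCre k Φ) = inner ℂ (siteAnn k Ψ) Φ :=
  inner_create_right _ _ _

lemma inner_self_eq_ofReal {ι : Type*} [Fintype ι] (v : Fock ι) :
    inner ℂ v v = ((‖v‖ ^ 2 : ℝ) : ℂ) := by
  rw [inner_self_eq_norm_sq_to_K]
  push_cast
  rfl

lemma nLoc_eq (x : Λ) : nLoc (N := N) x = occupation siteAnn siteCre (.inr x) := rfl

lemma fTot_eq (α β : Fin N) : fTot (Λ := Λ) α β = colorOp siteAnn siteCre α β := by
  rw [fTot, colorOp, Fintype.sum_sum_type, Finset.sum_add_distrib]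
  rfl

lemma nTot_apply (Ψ : Fock (Mode Λ N)) :
    nTot Ψ = ∑ o : Λ ⊕ Λ, occupation siteAnn siteCre o Ψ := by
  simp only [nTot, fTot_eq, colorOp, occupation, LinearMap.sum_apply]
  exact Finset.sum_comm

lemma mem_oneLocalized {Ψ : Fock (Mode Λ N)} :
    Ψ ∈ oneLocalized Λ N ↔ ∀ x : Λ, occupation siteAnn siteCre (.inr x) Ψ = Ψ := by
  simp [oneLocalized, Submodule.mem_iInf, LinearMap.mem_eqLocus, nLoc_eq]

lemma mem_numberSector {M : ℕ} {Ψ : Fock (Mode Λ N)} :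
    Ψ ∈ numberSector Λ N M ↔ nTot Ψ = (M : ℂ) • Ψ := by
  simp [numberSector, LinearMap.mem_eqLocus]

lemma sum_occupation_inl {D : ℕ} {Ψ : Fock (Mode Λ N)} (h1 : Ψ ∈ oneLocalized Λ N)
    (h2 : Ψ ∈ numberSector Λ N (D + Fintype.card Λ)) :
    ∑ x : Λ, occupation siteAnn siteCre (.inl x) Ψ = (D : ℂ) • Ψ := by
  rw [mem_numberSector, nTot_apply, Fintype.sum_sum_type,
    Finset.sum_congr rfl fun x _ => mem_oneLocalized.1 h1 x] at h2
  rw [eq_sub_of_add_eq h2, Finset.sum_const, Finset.card_univ, ← Nat.cast_smul_eq_nsmul ℂ,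
    ← sub_smul]
  push_cast
  rw [add_sub_cancel_right]

/-- A singly occupied orbital carries no pair of particles. -/
lemma siteAnn_siteAnn_of_occupation {Ψ : Fock (Mode Λ N)} {o : Λ ⊕ Λ}
    (hocc : occupation siteAnn siteCre o Ψ = Ψ) (α β : Fin N) :
    siteAnn (o, α) (siteAnn (o, β) Ψ) = 0 := by
  have h1 : occupation siteAnn siteCre o (siteAnn (o, β) Ψ) = 0 := by
    rw [isCAR_site.occupation_annihilate, hocc, if_pos rfl, sub_self]
  have h2 := congrArg (inner ℂ (siteAnn (o, β) Ψ)) h1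
  rw [occupation_apply, inner_sum, inner_zero_right] at h2
  simp only [inner_siteCre, inner_self_eq_ofReal] at h2
  have h3 : ∑ γ, ‖siteAnn (o, γ) (siteAnn (o, β) Ψ)‖ ^ 2 = 0 := by exact_mod_cast h2
  rw [Finset.sum_eq_zero_iff_of_nonneg fun _ _ => by positivity] at h3
  simpa using h3 α (Finset.mem_univ α)

section CasimirBound

variable {M : ℕ} {Ψ : Fock (Mode Λ N)}

/-- The deviation of the Casimir operator from its maximal value. -/
lemma casimir_apply (hN : 1 ≤ N) (hΨ : Ψ ∈ numberSector Λ N M) :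
    casimir Ψ = (maxCasimir N M : ℂ) • Ψ + (1 / 2 : ℂ) •
      ∑ α : Fin N, ∑ β : Fin N, ∑ o : Λ ⊕ Λ, ∑ p : Λ ⊕ Λ, siteCre (o, α) (siteCre (p, β)
        (siteAnn (o, α) (siteAnn (p, β) Ψ) - siteAnn (o, β) (siteAnn (p, α) Ψ))) := by
  have hN0 : (N : ℂ) ≠ 0 := Nat.cast_ne_zero.2 (by omega)
  have hn := mem_numberSector.1 hΨ
  have h1 := (isCAR_site (Λ := Λ) (N := N)).sum_colorOp_mul (M := M) (Ψ := Ψ)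
    (by rw [← hn, nTot]; simp [fTot_eq])
  simp only [casimir, fTot_eq, LinearMap.smul_apply, LinearMap.sub_apply, LinearMap.sum_apply,
    Module.End.mul_apply, hn, map_smul]
  rw [h1, Fintype.card_fin, maxCasimir, smul_sub, smul_add]
  rw [add_sub_right_comm]
  congr 1
  simp only [smul_smul, ← sub_smul]
  congr 1
  push_cast
  field_simp
  ring

lemma casimir_eq_of_symmetric (hN : 1 ≤ N) (hΨ : Ψ ∈ numberSector Λ N M)
    (hsym : ∀ o p, SymmetricPair siteAnn Ψ o p) : casimir Ψ = (maxCasimir N M : ℂ) • Ψ := by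
  rw [casimir_apply hN hΨ]
  simp only [fun o p α β => sub_eq_zero.2 (hsym o p α β), map_zero, Finset.sum_const_zero,
    smul_zero, add_zero]

lemma le_maxCasimir (hN : 1 ≤ N) (hΨ : Ψ ∈ numberSector Λ N M) (h0 : Ψ ≠ 0) {e : ℝ}
    (he : casimir Ψ = (e : ℂ) • Ψ) : e ≤ maxCasimir N M := by
  let X : Fin N → Fin N → Λ ⊕ Λ → Λ ⊕ Λ → Fock (Mode Λ N) :=
    fun α β o p => siteAnn (o, α) (siteAnn (p, β) Ψ)
  have h1 := casimir_apply hN hΨ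
  rw [he] at h1
  have h2 := congrArg (inner ℂ Ψ) h1
  simp only [inner_add_right, inner_smul_right, inner_sum, inner_siteCre] at h2
  have h3 : ∀ α β o p, inner ℂ (siteAnn (p, β) (siteAnn (o, α) Ψ))
      (siteAnn (o, α) (siteAnn (p, β) Ψ) - siteAnn (o, β) (siteAnn (p, α) Ψ)) =
      -inner ℂ (X α β o p) (X α β o p - X β α o p) := by
    intro α β o p
    rw [isCAR_site.aa, inner_neg_left]
  simp only [h3] at h2
  -- Averaging with the same sum after renaming `α` and `β` completes the square.
  have h4 : (∑ α, ∑ β, ∑ o, ∑ p, -inner ℂ (X α β o p) (X α β o p - X β α o p) : ℂ) =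
      -(1 / 2 : ℂ) * ((∑ α, ∑ β, ∑ o, ∑ p, ‖X α β o p - X β α o p‖ ^ 2 : ℝ) : ℂ) := by
    have h5 : (∑ α, ∑ β, ∑ o, ∑ p, -inner ℂ (X α β o p) (X α β o p - X β α o p) : ℂ) =
        ∑ α, ∑ β, ∑ o, ∑ p, inner ℂ (X β α o p) (X α β o p - X β α o p) := by
      rw [Finset.sum_comm]
      refine Finset.sum_congr rfl fun α _ => Finset.sum_congr rfl fun β _ =>
        Finset.sum_congr rfl fun o _ => Finset.sum_congr rfl fun p _ => ?_
      rw [← inner_neg_right, neg_sub]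
    have h6 : ((∑ α, ∑ β, ∑ o, ∑ p, ‖X α β o p - X β α o p‖ ^ 2 : ℝ) : ℂ) =
        -(∑ α, ∑ β, ∑ o, ∑ p, -inner ℂ (X α β o p) (X α β o p - X β α o p)) -
        ∑ α, ∑ β, ∑ o, ∑ p, inner ℂ (X β α o p) (X α β o p - X β α o p) := by
      simp only [Finset.sum_neg_distrib, neg_neg, ← Finset.sum_sub_distrib, ← inner_sub_left]
      simp only [inner_self_eq_ofReal]
      push_cast
      rfl
    rw [h6, ← h5]
    ring
  rw [h4, inner_self_eq_ofReal] at h2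
  have h7 : e * ‖Ψ‖ ^ 2 = maxCasimir N M * ‖Ψ‖ ^ 2 +
      1 / 2 * (-(1 / 2) * ∑ α, ∑ β, ∑ o, ∑ p, ‖X α β o p - X β α o p‖ ^ 2) := by
    apply Complex.ofReal_injective
    push_cast
    push_cast at h2
    exact h2
  have h8 : 0 ≤ ∑ α, ∑ β, ∑ o, ∑ p, ‖X α β o p - X β α o p‖ ^ 2 := by positivity
  have h9 : 0 < ‖Ψ‖ ^ 2 := by positivity
  nlinarith

end CasimirBound

/-- The amplitude of configuration `S` after removing an itinerant fermion of color `α`, as a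
function of the site of removal. -/
noncomputable def removalAmplitude (Ψ : Fock (Mode Λ N)) (α : Fin N) (S : Finset (Mode Λ N)) :
    Λ → ℂ :=
  fun x => siteAnn (.inl x, α) Ψ S

/-- The hopping part of the Hamiltonian. -/
noncomputable def hopping (T : Matrix Λ Λ ℂ) : Module.End ℂ (Fock (Mode Λ N)) :=
  ∑ α : Fin N, ∑ x, ∑ y, T x y • (cDag x α * c y α)

lemma hopping_apply (T : Matrix Λ Λ ℂ) (Ψ : Fock (Mode Λ N)) :
    hopping T Ψ = ∑ α : Fin N, ∑ x, siteCre (.inl x, α) (∑ y, T x y • siteAnn (.inl y, α) Ψ) := by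
  simp only [hopping, LinearMap.sum_apply, LinearMap.smul_apply, Module.End.mul_apply, map_sum,
    map_smul]
  rfl

/-- Hopping acts only on the site of removal, so the energy splits into one quadratic form of `T`
for each color and remaining configuration. -/
lemma inner_hopping (T : Matrix Λ Λ ℂ) (Ψ : Fock (Mode Λ N)) :
    inner ℂ Ψ (hopping T Ψ) = ∑ α : Fin N, ∑ S,
      star (removalAmplitude Ψ α S) ⬝ᵥ T.mulVec (removalAmplitude Ψ α S) := by
  rw [hopping_apply]
  rw [inner_sum]
  refine Finset.sum_congr rfl fun α _ => ?_
  rw [inner_sum]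
  simp only [inner_siteCre]
  simp only [PiLp.inner_apply, dotProduct, Matrix.mulVec]
  rw [Finset.sum_comm]
  refine Finset.sum_congr rfl fun S _ => ?_
  refine Finset.sum_congr rfl fun x _ => ?_
  simp [removalAmplitude, mul_comm]

lemma hopping_eq_zero {T : Matrix Λ Λ ℂ} {Ψ : Fock (Mode Λ N)}
    (h : ∀ α S, T.mulVec (removalAmplitude Ψ α S) = 0) : hopping T Ψ = 0 := by
  rw [hopping_apply]
  refine Finset.sum_eq_zero fun α _ => ?_
  refine Finset.sum_eq_zero fun x _ => ?_
  have : ∑ y, T x y • siteAnn (Sum.inl y, α) Ψ = (0 : Fock (Mode Λ N)) := by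
    ext S
    have := congrFun (h α S) x
    simpa [Matrix.mulVec, dotProduct, removalAmplitude] using this
  rw [this, map_zero]

/-- The operator transferring an itinerant fermion to the localized orbital of the same site and
the same color. -/
noncomputable def transfer (x : Λ) : Module.End ℂ (Fock (Mode Λ N)) :=
  ∑ β, siteCre (.inr x, β) * siteAnn (.inl x, β)

lemma transfer_apply (x : Λ) (Ψ : Fock (Mode Λ N)) :
    transfer x Ψ = ∑ β, siteCre (.inr x, β) (siteAnn (.inl x, β) Ψ) := by
  simp [transfer, LinearMap.sum_apply]

/-- The energy of the fully polarized states. -/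
noncomputable def polarizedEnergy (N D : ℕ) (J : ℝ) : ℝ := J * (1 - 1 / N) * D

variable {T : Matrix Λ Λ ℂ} {G : Fin (N ^ 2 - 1) → Matrix (Fin N) (Fin N) ℂ} {J : ℝ} {D : ℕ}
  {Ψ : Fock (Mode Λ N)}

/-- This is the form in which the energy, up to a constant, is a sum of nonnegative terms when `T ≥
0` and `J < 0`. -/
lemma hamiltonian_apply (hN : 1 ≤ N) (hG : IsSUGenerators G) (h1 : Ψ ∈ oneLocalized Λ N)
    (h2 : Ψ ∈ numberSector Λ N (D + Fintype.card Λ)) :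
    hamiltonian T J G Ψ = hopping T Ψ + ((polarizedEnergy N D J : ℂ) • Ψ -
      (J : ℂ) • ∑ x, ∑ α, siteCre (.inl x, α) (siteAnn (.inr x, α) (transfer x Ψ))) := by
  have h3 : ∀ x : Λ, ∑ A, spinItin (G A) x (spinLoc (G A) x Ψ) =
      (1 - 1 / (N : ℂ)) • occupation siteAnn siteCre (.inl x) Ψ -
        ∑ α, siteCre (.inl x, α) (siteAnn (.inr x, α) (transfer x Ψ)) := by
    intro x
    rw [transfer_apply]
    exact isCAR_site.sum_spin_mul_spin (hG.sum_mul hN) (o := .inl x) (p := .inr x)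
      Sum.inl_ne_inr (mem_oneLocalized.1 h1 x)
  simp only [hamiltonian, LinearMap.add_apply, LinearMap.smul_apply, LinearMap.sum_apply,
    Module.End.mul_apply, h3, Finset.sum_sub_distrib, ← Finset.smul_sum]
  rw [sum_occupation_inl h1 h2, smul_sub, smul_smul, smul_smul]
  simp only [hopping, LinearMap.sum_apply, LinearMap.smul_apply, Module.End.mul_apply,
    polarizedEnergy]
  push_cast
  rw [mul_assoc]

lemma inner_exchange (x : Λ) :
    inner ℂ Ψ (∑ α, siteCre (.inl x, α) (siteAnn (.inr x, α) (transfer x Ψ))) =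
      ((‖transfer x Ψ‖ ^ 2 : ℝ) : ℂ) := by
  rw [← inner_self_eq_ofReal]
  rw [inner_sum, ← inner_conj_symm (transfer x Ψ), transfer_apply, inner_sum, map_sum]
  refine Finset.sum_congr rfl fun α _ => ?_
  rw [inner_conj_symm, inner_siteCre, ← inner_conj_symm (siteCre _ _), inner_siteCre,
    inner_conj_symm]

/-- A state whose energy does not exceed that of the polarized states is annihilated by the hopping
and by all the transfer operators. -/
lemma zero_of_energy_le (hN : 1 ≤ N) (hT : T.PosSemidef) (hG : IsSUGenerators G) (hJ : J < 0)
    (h1 : Ψ ∈ oneLocalized Λ N) (h2 : Ψ ∈ numberSector Λ N (D + Fintype.card Λ)) {e : ℝ}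
    (he : e ≤ polarizedEnergy N D J) (hH : hamiltonian T J G Ψ = (e : ℂ) • Ψ) :
    (∀ α S, T.mulVec (removalAmplitude Ψ α S) = 0) ∧ ∀ x, transfer x Ψ = 0 := by
  rw [hamiltonian_apply hN hG h1 h2] at hH
  have h3 := congrArg (fun v => (inner ℂ Ψ v : ℂ).re) hH
  simp only [inner_add_right, inner_sub_right, inner_smul_right, inner_hopping] at h3
  rw [inner_sum] at h3
  simp only [inner_exchange] at h3
  rw [inner_self_eq_ofReal] at h3
  have hpos : ∀ α S, 0 ≤ (star (removalAmplitude Ψ α S) ⬝ᵥ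
      T.mulVec (removalAmplitude Ψ α S)).re :=
    fun α S => (Complex.nonneg_iff.1 (hT.dotProduct_mulVec_nonneg _)).1
  have h4 : ∑ α, ∑ S, (star (removalAmplitude Ψ α S) ⬝ᵥ
      T.mulVec (removalAmplitude Ψ α S)).re + (polarizedEnergy N D J * ‖Ψ‖ ^ 2 -
      J * ∑ x, ‖transfer x Ψ‖ ^ 2) = e * ‖Ψ‖ ^ 2 := by
    have e1 : ∀ r s : ℝ, ((r : ℂ) * ((s ^ 2 : ℝ) : ℂ)).re = r * s ^ 2 := by
      intro r s; norm_cast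
    have e2 : ((J : ℂ) * ∑ x, ((‖transfer x Ψ‖ ^ 2 : ℝ) : ℂ)).re =
        J * ∑ x, ‖transfer x Ψ‖ ^ 2 := by norm_cast
    simp only [Complex.add_re, Complex.sub_re, e2, Complex.re_sum] at h3
    have e3 := e1 (polarizedEnergy N D J) ‖Ψ‖
    have e4 := e1 e ‖Ψ‖
    rw [← e3, ← e4]
    exact h3
  have h5 : 0 ≤ ∑ α, ∑ S, (star (removalAmplitude Ψ α S) ⬝ᵥ
      T.mulVec (removalAmplitude Ψ α S)).re :=
    Finset.sum_nonneg fun α _ => Finset.sum_nonneg fun S _ => hpos α S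
  have h6 : 0 ≤ ∑ x, ‖transfer x Ψ‖ ^ 2 := by positivity
  have h7 : 0 ≤ ‖Ψ‖ ^ 2 := by positivity
  -- Strict negativity of `J` is needed here: the nonnegative excess over `polarizedEnergy` must
  -- vanish.
  have h8 : ∑ x, ‖transfer x Ψ‖ ^ 2 = 0 := by nlinarith
  have h9 : ∑ α, ∑ S, (star (removalAmplitude Ψ α S) ⬝ᵥ
      T.mulVec (removalAmplitude Ψ α S)).re = 0 := by nlinarith
  constructor
  · intro α S
    rw [Finset.sum_eq_zero_iff_of_nonneg fun α _ => Finset.sum_nonneg fun S _ => hpos α S] at h9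
    have h10 := h9 α (Finset.mem_univ α)
    rw [Finset.sum_eq_zero_iff_of_nonneg fun S _ => hpos α S] at h10
    have h11 := h10 S (Finset.mem_univ S)
    refine (hT.dotProduct_mulVec_zero_iff _).1 (Complex.ext h11 ?_)
    exact (Complex.nonneg_iff.1 (hT.dotProduct_mulVec_nonneg _)).2.symm
  · intro x
    rw [Finset.sum_eq_zero_iff_of_nonneg fun _ _ => by positivity] at h8
    simpa using h8 x (Finset.mem_univ x)

end Sites

/-! ### Non-orthogonal flat-band orbitals and the spread of color symmetry -/

section Orbitals

variable {Λ : Type*} [Fintype Λ] [DecidableEq Λ] {N : ℕ} {κ : Type*}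

/-- Annihilation operators of the orbitals consisting of the itinerant sites `e z` and all the
localized sites. -/
noncomputable def orbitalAnn (e : κ → Λ) (k : (κ ⊕ Λ) × Fin N) :
    Module.End ℂ (Fock (Mode Λ N)) :=
  siteAnn (Sum.elim (fun z => .inl (e z)) .inr k.1, k.2)

/-- Creation operators dual to `orbitalAnn`: the flat band states `ν z` and all the localized
sites. -/
noncomputable def orbitalCre (ν : κ → Λ → ℂ) (k : (κ ⊕ Λ) × Fin N) :
    Module.End ℂ (Fock (Mode Λ N)) :=
  Sum.elim (fun z => ∑ y, ν z y • siteCre (.inl y, k.2)) (fun x => siteCre (.inr x, k.2)) k.1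

lemma orbitalCre_inl (ν : κ → Λ → ℂ) (z : κ) (α : Fin N) (Ψ : Fock (Mode Λ N)) :
    orbitalCre ν (.inl z, α) Ψ = ∑ y, ν z y • siteCre (.inl y, α) Ψ := by
  simp [orbitalCre, LinearMap.sum_apply]

lemma orbitalCre_inr (ν : κ → Λ → ℂ) (x : Λ) (α : Fin N) :
    orbitalCre ν (.inr x, α) = siteCre (.inr x, α) := rfl

lemma orbitalAnn_inl (e : κ → Λ) (z : κ) (α : Fin N) :
    orbitalAnn e (.inl z, α) = siteAnn (.inl (e z), α) := rfl

lemma orbitalAnn_inr (e : κ → Λ) (x : Λ) (α : Fin N) :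
    orbitalAnn e (.inr x, α) = siteAnn (.inr x, α) := rfl

lemma siteAnn_inl_orbitalCre_inl (ν : κ → Λ → ℂ) (x : Λ) (z : κ) (α β : Fin N)
    (v : Fock (Mode Λ N)) : siteAnn (.inl x, α) (orbitalCre ν (.inl z, β) v) =
      (if α = β then ν z x • v else 0) - orbitalCre ν (.inl z, β) (siteAnn (.inl x, α) v) := by
  simp only [orbitalCre_inl, map_sum, map_smul, isCAR_site.ad, smul_sub, Finset.sum_sub_distrib,
    Prod.mk.injEq, Sum.inl.injEq]
  congr 1
  by_cases h : α = β <;> simp [h]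

lemma siteAnn_inr_orbitalCre_inl (ν : κ → Λ → ℂ) (x : Λ) (z : κ) (α β : Fin N)
    (v : Fock (Mode Λ N)) : siteAnn (.inr x, α) (orbitalCre ν (.inl z, β) v) =
      - orbitalCre ν (.inl z, β) (siteAnn (.inr x, α) v) := by
  simp only [orbitalCre_inl, map_sum, map_smul, isCAR_site.ad, smul_sub, Finset.sum_sub_distrib,
    Prod.mk.injEq]
  simp

lemma siteCre_orbitalCre_inl (ν : κ → Λ → ℂ) (k : (Λ ⊕ Λ) × Fin N) (z : κ) (β : Fin N)
    (v : Fock (Mode Λ N)) : siteCre k (orbitalCre ν (.inl z, β) v) =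
      - orbitalCre ν (.inl z, β) (siteCre k v) := by
  simp only [orbitalCre_inl, map_sum, map_smul, isCAR_site.dd k, smul_neg, Finset.sum_neg_distrib]

/-- The mixed anticommutator of orbitals `z` and `w` is a value of `ν` at a dual site, so duality
replaces orthonormality. -/
lemma isCAR_orbital [DecidableEq κ] {e : κ → Λ} {ν : κ → Λ → ℂ}
    (hν : ∀ z w, ν z (e w) = if z = w then 1 else 0) :
    IsCAR (orbitalAnn (N := N) e) (orbitalCre ν) where
  aa i j v := isCAR_site.aa _ _ _
  dd := by
    rintro ⟨z | x, α⟩ ⟨w | y, β⟩ v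
    · rw [orbitalCre_inl, orbitalCre_inl ν z]
      simp only [siteCre_orbitalCre_inl, map_sum, map_smul, smul_neg, Finset.sum_neg_distrib]
    · rw [orbitalCre_inr, siteCre_orbitalCre_inl, neg_neg]
    · rw [orbitalCre_inr, siteCre_orbitalCre_inl]
    · exact isCAR_site.dd _ _ _
  ad := by
    rintro ⟨z | x, α⟩ ⟨w | y, β⟩ v
    · rw [orbitalAnn_inl, siteAnn_inl_orbitalCre_inl, hν]
      by_cases h1 : α = β <;> by_cases h2 : z = w <;> simp [h1, h2, eq_comm (a := w)]
    · rw [orbitalAnn_inl, orbitalCre_inr, isCAR_site.ad]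
      simp
    · rw [orbitalAnn_inr, siteAnn_inr_orbitalCre_inl]
      simp
    · rw [orbitalAnn_inr, orbitalCre_inr, isCAR_site.ad]
      simp

variable [Fintype κ]

/-- All itinerant fermions of `Ψ` are in the span of the flat band states `ν z`. -/
def IsFlat (e : κ → Λ) (ν : κ → Λ → ℂ) (Ψ : Fock (Mode Λ N)) : Prop :=
  ∀ x α, siteAnn (.inl x, α) Ψ = ∑ z, ν z x • siteAnn (.inl (e z), α) Ψ

variable {T : Matrix Λ Λ ℂ} {e : κ → Λ} {ν : κ → Λ → ℂ} {Ψ : Fock (Mode Λ N)}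

lemma isFlat_of_removalAmplitude
    (hexp : ∀ v : Λ → ℂ, T.mulVec v = 0 → ∀ x, v x = ∑ z, ν z x * v (e z))
    (h : ∀ α S, T.mulVec (removalAmplitude Ψ α S) = 0) : IsFlat e ν Ψ := by
  intro x α
  ext S
  simpa [removalAmplitude] using hexp _ (h α S) x

lemma IsFlat.removalAmplitude (hΨ : IsFlat e ν Ψ) (hν : ∀ z, T.mulVec (ν z) = 0) (α : Fin N)
    (S : Finset (Mode Λ N)) : T.mulVec (removalAmplitude Ψ α S) = 0 := by
  have : KondoLattice.removalAmplitude Ψ α S =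
      ∑ z, siteAnn (.inl (e z), α) Ψ S • ν z := by
    ext x
    simp [KondoLattice.removalAmplitude, hΨ x α, mul_comm]
  rw [this, Matrix.mulVec_sum]
  exact Finset.sum_eq_zero fun z _ => by rw [Matrix.mulVec_smul, hν, smul_zero]

/-- On flat states the coefficients `ν z x` can be moved from the annihilation to the creation
operators. -/
lemma IsFlat.sum_occupation (hΨ : IsFlat e ν Ψ) :
    ∑ o, occupation (orbitalAnn e) (orbitalCre ν) o Ψ = nTot Ψ := by
  rw [nTot_apply, Fintype.sum_sum_type, Fintype.sum_sum_type]
  congr 1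
  simp only [occupation_apply, orbitalAnn_inl, orbitalCre_inl]
  have h1 : ∀ x : Λ, ∑ γ, siteCre (.inl x, γ) (siteAnn (.inl x, γ) Ψ) =
      ∑ γ, ∑ z, ν z x • siteCre (.inl x, γ) (siteAnn (.inl (e z), γ) Ψ) := by
    intro x
    refine Finset.sum_congr rfl fun γ _ => ?_
    rw [hΨ x γ, map_sum]
    simp only [map_smul]
  simp only [h1]
  rw [Finset.sum_comm, Finset.sum_comm (s := (Finset.univ : Finset Λ))]
  refine Finset.sum_congr rfl fun γ _ => ?_
  exact Finset.sum_comm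

variable [DecidableEq κ]

/-- Single occupancy reduces the local relations to a connectivity question: `z` is joined to the
localized site `x` when `ν z x ≠ 0`, and irreducibility makes this graph connect all localized
sites. -/
lemma IsFlat.symmetricPair (hΨ : IsFlat e ν Ψ)
    (hdual : ∀ z w, ν z (e w) = if z = w then 1 else 0) (hν : ∀ z, T.mulVec (ν z) = 0)
    (hexp : ∀ v : Λ → ℂ, T.mulVec v = 0 → ∀ x, v x = ∑ z, ν z x * v (e z))
    (hirr : ¬ IsReducibleOn (flatBandProj T) Set.univ)
    (h1 : Ψ ∈ oneLocalized Λ N) (h2 : Ψ ∈ numberSector Λ N (Fintype.card κ + Fintype.card Λ))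
    (htr : ∀ x, transfer x Ψ = 0) (o p : Λ ⊕ Λ) : SymmetricPair siteAnn Ψ o p := by
  have hloc := mem_oneLocalized.1 h1
  have hCAR := isCAR_orbital (N := N) hdual
  have hfc : ∀ x : Λ, SymmetricPair siteAnn Ψ (.inr x) (.inl x) := fun x =>
    isCAR_site.symmetricPair_of_exchange
      (siteAnn_siteAnn_of_occupation (hloc x)) (by rw [← transfer_apply, htr])
  have hcc : ∀ (x : Λ) α β, siteAnn (.inl x, α) (siteAnn (.inl x, β) Ψ) = 0 := fun x =>
    isCAR_site.exclusion_of_exchange Sum.inl_ne_inr (hloc x) (hfc x)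
  have hex : ∀ (o : κ ⊕ Λ) α β, orbitalAnn e (o, α) (orbitalAnn e (o, β) Ψ) = 0 := by
    rintro (z | x) α β
    · exact hcc _ _ _
    · exact siteAnn_siteAnn_of_occupation (hloc x) α β
  have hocc := hCAR.occupation_eq_self (Ψ := Ψ)
    (by rw [hΨ.sum_occupation, mem_numberSector.1 h2, Fintype.card_sum]) hex
  have hedge : ∀ z x, ν z x ≠ 0 → SymmetricPair (orbitalAnn e) Ψ (.inl z) (.inr x) := by
    intro z x hzx
    refine hCAR.symmetricPair_of_sum hocc (e := Sum.inl) Sum.inl_injective (o := .inr x)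
      (fun _ => Sum.inr_ne_inl) (fun z => ν z x) ?_ hzx
    intro α β
    have h3 := isCAR_site.symmetricPair_symm (hfc x) α β
    rw [isCAR_site.aa, isCAR_site.aa (.inl x, β), hΨ x α, hΨ x β, neg_inj] at h3
    simp only [map_sum, map_smul] at h3
    simp only [orbitalAnn_inl, orbitalAnn_inr, smul_sub, Finset.sum_sub_distrib]
    simp only [isCAR_site.aa (.inl (e _), _) (.inr x, _), smul_neg, Finset.sum_neg_distrib, h3,
      sub_self]
  have htrans := fun {o p q} => hCAR.symmetricPair_trans hocc (o := o) (p := p) (q := q)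
  have hsymm := fun {o p} => hCAR.symmetricPair_symm (Ψ := Ψ) (o := o) (p := p)
  have hrefl : ∀ o, SymmetricPair (orbitalAnn e) Ψ o o := fun o α β => by rw [hex, hex]
  have hff : ∀ x y : Λ, SymmetricPair (orbitalAnn e) Ψ (.inr x) (.inr y) := by
    intro y x
    by_contra hx
    -- The symmetry class of `y` is a proper nonempty set of sites, and every `ν z` is supported
    -- inside it or outside it.
    refine hirr ⟨{x | SymmetricPair (orbitalAnn e) Ψ (.inr y) (.inr x)}ᶜ,
      {x | SymmetricPair (orbitalAnn e) Ψ (.inr y) (.inr x)}, Set.compl_union_self _,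
      Set.compl_inter_self _, ⟨x, hx⟩, ⟨y, hrefl _⟩, fun x hx y hy => ?_⟩
    exact flatBandProj_eq_zero hν hexp _ {z | SymmetricPair (orbitalAnn e) Ψ (.inr _) (.inl z)}
      (fun z x hzx => ⟨fun h => htrans h (hedge z x hzx),
        fun h => htrans h (hsymm (hedge z x hzx))⟩) hx hy
  have hcf : ∀ z x, SymmetricPair (orbitalAnn e) Ψ (.inl z) (.inr x) := fun z x =>
    htrans (hedge z (e z) (by simp [hdual])) (hff _ x)
  have hall : ∀ o p, SymmetricPair (orbitalAnn e) Ψ o p := by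
    rintro (z | x) (w | y)
    · exact htrans (hcf z (e z)) (hsymm (hcf w (e z)))
    · exact hcf z y
    · exact hsymm (hcf w x)
    · exact hff x y
  -- Flatness extends the symmetry from the chosen orbitals to all sites by linearity, one argument
  -- at a time.
  have hext : ∀ q : κ ⊕ Λ, ∀ o,
      SymmetricPair siteAnn Ψ o (Sum.elim (fun z => .inl (e z)) .inr q) := by
    rintro q (x | x)
    · refine isCAR_site.symmetricPair_symm fun α β => ?_
      rw [hΨ x α, hΨ x β]
      simp only [map_sum, map_smul]
      exact Finset.sum_congr rfl fun z _ => congrArg _ (hall q (.inl z) α β)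
    · exact hall (.inr x) q
  rcases p with x | x
  · intro α β
    rw [hΨ x α, hΨ x β]
    simp only [map_sum, map_smul]
    exact Finset.sum_congr rfl fun z _ => congrArg _ (hext (.inl z) o α β)
  · exact hext (.inr x) o

/-- The fully polarized states exist, and they have zero hopping and exchange energy. -/
lemma exists_polarized_state (hN : 1 ≤ N)
    (hdual : ∀ z w, ν z (e w) = if z = w then 1 else 0) :
    ∃ Φ : Fock (Mode Λ N), Φ ≠ 0 ∧ Φ ∈ oneLocalized Λ N ∧
      Φ ∈ numberSector Λ N (Fintype.card κ + Fintype.card Λ) ∧ IsFlat e ν Φ ∧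
      ∀ x, transfer x Φ = 0 := by
  have hCAR := isCAR_orbital (N := N) hdual
  -- Flatness means that all `b` annihilate the state. By duality the contraction of `b` with the
  -- creation operator of `z` is `ν z x - ν z x = 0`.
  let b : Λ × Fin N → Module.End ℂ (Fock (Mode Λ N)) := fun i =>
    siteAnn (.inl i.1, i.2) - ∑ z, ν z i.1 • siteAnn (.inl (e z), i.2)
  have hbapp : ∀ x α v, b (x, α) v =
      siteAnn (.inl x, α) v - ∑ z, ν z x • siteAnn (.inl (e z), α) v := by
    intro x α v; simp [b, LinearMap.sum_apply]
  have hb : ∀ i j v, b i (orbitalCre ν j v) = -orbitalCre ν j (b i v) := by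
    rintro ⟨x, α⟩ ⟨w | y, β⟩ v
    · simp only [hbapp, siteAnn_inl_orbitalCre_inl, hdual, map_sub, map_sum, map_smul, smul_sub,
        Finset.sum_sub_distrib]
      by_cases h : α = β
      · simp [h]
      · simp [h]; abel
    · simp only [hbapp, orbitalCre_inr, isCAR_site.ad, map_sub, map_sum, map_smul, smul_sub]
      simp
      abel
  let vac : Fock (Mode Λ N) := EuclideanSpace.single ∅ 1
  have ha : ∀ k, siteAnn k vac = 0 := by
    intro k
    ext S
    simp only [siteAnn, annihilate_apply, vac]
    split_ifs <;> simp
  obtain ⟨Φ, h0, h1, h2, h3⟩ := hCAR.exists_polarized b hb (vac := vac)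
    (by simp [vac]) (fun k => ha _) (fun i => by rw [hbapp]; simp [ha]) ⟨0, hN⟩
  have hflat : IsFlat e ν Φ := fun x α => by
    rw [← sub_eq_zero, ← hbapp, h3]
  have hocc : ∀ o, occupation (orbitalAnn e) (orbitalCre ν) o Φ = Φ := fun o =>
    hCAR.occupation_of_polarized (h1 o) (h2 o)
  refine ⟨Φ, h0, mem_oneLocalized.2 fun x => hocc (.inr x), ?_, hflat, fun x => ?_⟩
  · rw [mem_numberSector, ← hflat.sum_occupation, Finset.sum_congr rfl fun o _ => hocc o,
      Finset.sum_const, Finset.card_univ, Fintype.card_sum, Nat.cast_smul_eq_nsmul]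
  · rw [transfer_apply]
    refine Finset.sum_eq_zero fun β _ => ?_
    -- In the filled color the localized orbital is already occupied. In any other color there is no
    -- itinerant fermion to transfer.
    by_cases hβ : β = ⟨0, hN⟩
    · have h4 := isCAR_site.ad (.inl x, β) (.inr x, β) Φ
      have h5 : siteCre (.inr x, β) Φ = 0 := by rw [hβ]; exact h2 (.inr x)
      rw [h5, map_zero, if_neg (by simp), zero_sub, eq_comm, neg_eq_zero] at h4
      exact h4
    · rw [hflat x β, Finset.sum_eq_zero, map_zero]
      intro z _
      rw [← orbitalAnn_inl, h1 (.inl z) β hβ, smul_zero]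

end Orbitals

/-- Flat-band ferromagnetism of the SU(N) Kondo lattice model; a flat band of positive dimension is
not needed. -/
theorem exhibitsFerromagnetism_of_irreducible {Λ : Type*} [Fintype Λ] [DecidableEq Λ]
    (N : ℕ) (hN : 1 ≤ N) (T : Matrix Λ Λ ℂ) (hT : T.PosSemidef)
    (G : Fin (N ^ 2 - 1) → Matrix (Fin N) (Fin N) ℂ) (hG : IsSUGenerators G)
    (J : ℝ) (hJ : J < 0)
    (hcover : flatBandSites T = Set.univ)
    (hirr : ¬ IsReducibleOn (flatBandProj T)
      (flatBandSites T)) :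
    ExhibitsFerromagnetism T J G
      (flatBandDim T + Fintype.card Λ) := by
  rw [hcover] at hirr
  obtain ⟨κ, _, _, e, ν, hcard, hdual, hν, hexp⟩ := exists_dual_sites T
  rw [← hcard]
  obtain ⟨Φ, h0, h1, h2, h3, h4⟩ := exists_polarized_state hN hdual
  refine ⟨⟨⟨Φ, h2, h0, casimir_eq_of_symmetric hN h2
    (h3.symmetricPair hdual hν hexp hirr h1 h2 h4)⟩, ?_⟩, ?_⟩
  · rintro r ⟨Ψ, hΨ, hΨ0, hr⟩
    exact le_maxCasimir hN hΨ hΨ0 hr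
  · rintro Ψ ⟨⟨hΨ1, hΨ2⟩, -, r, ⟨-, hr⟩, hH⟩
    -- The polarized state serves as a trial state bounding the ground state energy from above.
    have hE : polarizedEnergy N (Fintype.card κ) J ∈ eigenvaluesIn
        (oneLocalized Λ N ⊓ numberSector Λ N (Fintype.card κ + Fintype.card Λ))
        (hamiltonian T J G) := by
      refine ⟨Φ, ⟨h1, h2⟩, h0, ?_⟩
      rw [hamiltonian_apply hN hG h1 h2, hopping_eq_zero (h3.removalAmplitude hν)]
      simp [h4]
    obtain ⟨h5, h6⟩ := zero_of_energy_le hN hT hG hJ hΨ1 hΨ2 (hr hE) hH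
    exact casimir_eq_of_symmetric hN hΨ2
      ((isFlat_of_removalAmplitude hexp h5).symmetricPair hdual hν hexp hirr hΨ1 hΨ2 h6)

end KondoLattice

theorem theorem2 {Λ : Type*} [Fintype Λ] [DecidableEq Λ] (N : ℕ) (hN : 1 ≤ N)
    (T : Matrix Λ Λ ℂ) (hT : T.PosSemidef) (hD : 0 < KondoLattice.flatBandDim T)
    (G : Fin (N ^ 2 - 1) → Matrix (Fin N) (Fin N) ℂ) (hG : KondoLattice.IsSUGenerators G)
    (J : ℝ) (hJ : J < 0)
    (hcover : KondoLattice.flatBandSites T = Set.univ)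
    (hirr : ¬ KondoLattice.IsReducibleOn (KondoLattice.flatBandProj T)
      (KondoLattice.flatBandSites T)) :
    KondoLattice.ExhibitsFerromagnetism T J G
      (KondoLattice.flatBandDim T + Fintype.card Λ) := by
  exact KondoLattice.exhibitsFerromagnetism_of_irreducible N hN T hT G hG J hJ hcover hirr
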